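/- All graphs are finite, simple and undirected. For a graph $G$ let $\omega(G)$ be the number of its connected components. A set $S\subseteq V(G)$ is a cutset if $G-S$ is disconnected. For $t>0$, $G$ is $t$-tough if $\omega(G-S)\le |S|/t$ for every cutset $S$; the toughness $\tau(G)$ is the largest $t>0$ for which $G$ is $t$-tough, with $\tau(G)=\infty$ if $G$ is complete and $\tau(G)=0$ if $G$ is disconnected. $G$ is minimally $t$-tough if $\tau(G)=t$ and $\tau(G-e)<t$ for every edge $e$ of $G$. $G$ is a split graph if $V(G)$ can be partitioned into a clique and an independent set (either of which may be empty). Corollary. For every fixed positive rational number $t$, the class of minimally $t$-tough split graphs can be recognized in polynomial time: the set of binary strings that list, row by row, the adjacency matrix of a minimally $t$-tough split graph on a vertex set $\{0,\dots,n-1\}$, $n\ge 0$, is in the complexity class P, i.e. there is a deterministic Turing machine, which may depend on $t$, that decides for every binary string whether it belongs to this set, in a number of steps bounded by a polynomial in the length of the string. (In particular, it can be decided in polynomial time whether a given split graph is minimally $t$-tough.) -/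

import Mathlib

open scoped ENNReal

noncomputable section

namespace ToughSplit

variable {V : Type*}

/-- `G - S`: the graph obtained from `G` by deleting the vertices in `S`. -/
def removeVerts (G : SimpleGraph V) (S : Finset V) : SimpleGraph ↥((S : Set V)ᶜ) :=
  G.induce ((S : Set V)ᶜ)

/-- `ω(G)`: the number of connected components (for graphs with finitely many vertices). -/
def numComponents (G : SimpleGraph V) : ℕ :=
  Nat.card G.ConnectedComponent

/-- A vertex set `S` is a cutset of `G` if `G - S` is disconnected, i.e. two of its vertices are
not joined by a path. (The set `S` may be empty, if `G` itself is disconnected.) -/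
def IsCutset (G : SimpleGraph V) (S : Finset V) : Prop :=
  ¬ (removeVerts G S).Preconnected

/-- `G` is `t`-tough if `ω(G - S) ≤ |S| / t` for every cutset `S` of `G`. Meant for `t > 0`. -/
def IsTough (G : SimpleGraph V) (t : ℝ) : Prop :=
  ∀ S : Finset V, IsCutset G S → (numComponents (removeVerts G S) : ℝ) ≤ (S.card : ℝ) / t

/-- The toughness `τ(G)`, i.e. the largest `t > 0` for which `G` is `t`-tough. It is `∞` if `G` is
complete (then there is no cutset), and `0` if `G` is disconnected (then no `t > 0` qualifies). -/
def toughness (G : SimpleGraph V) : ℝ≥0∞ :=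
  sSup {x : ℝ≥0∞ | ∃ t : ℝ, 0 < t ∧ IsTough G t ∧ x = ENNReal.ofReal t}

/-- `G` is minimally `t`-tough if `τ(G) = t` and `τ(G - e) < t` for every edge `e`. -/
def IsMinimallyTough (G : SimpleGraph V) (t : ℝ) : Prop :=
  toughness G = ENNReal.ofReal t ∧
    ∀ e ∈ G.edgeSet, toughness (G.deleteEdges {e}) < ENNReal.ofReal t

/-- `G` is a split graph if its vertices can be partitioned into a clique `C` and an independent
set `Cᶜ` (either part may be empty). -/
def IsSplit (G : SimpleGraph V) : Prop :=
  ∃ C : Set V, G.IsClique C ∧ G.IsIndepSet Cᶜ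

open Classical in
/-- The binary string of length `n²` that lists the adjacency matrix of a graph on the vertex set
`{0, …, n - 1}` row by row. -/
def encodeGraph {n : ℕ} (G : SimpleGraph (Fin n)) : List Bool :=
  List.ofFn fun k : Fin (n * n) => decide (G.Adj k.divNat k.modNat)

/-- A graph is determined by its encoding (including the number of its vertices). -/
theorem encodeGraph_injective :
    Function.Injective
      (fun G : (Σ n : ℕ, SimpleGraph (Fin n)) => encodeGraph G.2) := by
  rintro ⟨n, G⟩ ⟨m, H⟩ h
  have hl : n * n = m * m := by
    have := congrArg List.length h
    simpa [encodeGraph] using this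
  obtain rfl : n = m := Nat.mul_self_inj.mp hl
  congr 1
  have h' := List.ofFn_injective h
  ext i j
  have := congrFun h' (finProdFinEquiv (i, j))
  have e1 := congrArg Prod.fst (finProdFinEquiv.symm_apply_apply (i, j))
  have e2 := congrArg Prod.snd (finProdFinEquiv.symm_apply_apply (i, j))
  simp only [finProdFinEquiv_symm_apply] at e1 e2
  rw [e1, e2] at this
  simpa using this

open Classical in
/-- The complexity class P: the language `L` of binary strings is decided by a deterministic Turing
machine (with finitely many stacks, see `Turing.FinTM2`) which, on every binary string `w`, halts
with the one-bit answer to `w ∈ L` after a number of steps bounded by a polynomial in the length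
of `w`. -/
def InP (L : Set (List Bool)) : Prop :=
  Nonempty (Turing.TM2ComputableInPolyTime (id : List Bool → List Bool) Computability.encodeBool
    (fun w : List Bool => decide (w ∈ L)))

end ToughSplit

end

/-!
For a fixed rational `t > 0`, the minimally `t`-tough split graphs turn out to be so few that they
can be recognized by inspection of the adjacency matrix.

*Structure.* Let `G` be a minimally `t`-tough split graph, with a clique `C` and an independent
complement. Moving a vertex to the complement if necessary, every vertex of `C` has a neighbour
outside `C`. If `uv` is an edge of `C`, then a set witnessing that `G - uv` is not `t`-tough must
separate `u` from `v`, hence contain the rest of `C` and all common neighbours; this gives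
`|C| - 2 + B < t (2 + A)`, where `B` counts the common neighbours of `u` and `v` outside `C`, and `A`
the vertices outside `C` adjacent to neither (`IsTough.lt_of_critical`). Toughness itself bounds
`|S|` from below for every `S ⊆ C` that isolates some of the outer vertices. If `B > 0`, the two kinds
of inequality show first that `u` and `v` have the same outer neighbours (`twins_of_common`), and
then a contradiction (`eq_of_common`). Therefore every vertex outside `C` is pendant. For such a graph
toughness says that `t (ℓ(x) + 1) ≤ 1` for all `x ∈ C`, where `ℓ(x)` is the number of pendant
vertices at `x`; that `t` is the exact toughness says that equality occurs, so that `t = 1 / m` for an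
integer `m ≥ 2`; and summing the inequalities shows that `|C| ≤ 3`, with `ℓ(x) = m - 1` for all `x`
if `|C| = 3` (`exists_isExtremal`). Conversely the graphs described in this way (`IsExtremal`) are
minimally `1 / m`-tough (`IsExtremal.isMinimallyTough`).

*Machines.* Being the adjacency matrix of such a graph is expressed by quantifiers ranging over the
vertices, comparisons of numbers of vertices with constants, and bits of the string. All of this can
be written as an arithmetic expression built from the bits by addition, truncated subtraction and
bounded summation (`Expr`). Expressions are evaluated by a small command language for stacks, with
numbers in unary (`Expr.BoundedBy`, `Expr.exists_boundedBy`). Nested bounded summation keeps values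
and times polynomial. The commands are compiled into Turing machines step by step (`Cmd.compile`,
`Exec.stepsTo`), so that every language defined by an expression is in P (`inP_of_expr`).
-/

namespace ToughSplit

open Function

/-! ### A command language for stack machines -/

/-- Commands acting on finitely many stacks of bits, indexed by natural numbers. -/
inductive Cmd : Type
  /-- Look at the top `o` of stack `a` (`none` if empty) and push the bit `f o`, if any, on `b`. -/
  | prim (a : ℕ) (f : Option Bool → Option Bool) (b : ℕ)
  /-- Remove the top of stack `a`. -/
  | pop (a : ℕ)
  | seq (c d : Cmd)
  /-- While stack `a` is nonempty, pop it and run `c₀` or `c₁` according to the bit popped. -/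
  | loop (a : ℕ) (c₀ c₁ : Cmd)

/-- `Exec c S S' n`: started on the stacks `S`, the command `c` ends with the stacks `S'` after at
most `n` steps. -/
inductive Exec : Cmd → (ℕ → List Bool) → (ℕ → List Bool) → ℕ → Prop
  | prim (a f b S) : Exec (.prim a f b) S (update S b ((f (S a).head?).toList ++ S b)) 1
  | pop (a S) : Exec (.pop a) S (update S a (S a).tail) 1
  | seq {c d S S' S'' m n} : Exec c S S' m → Exec d S' S'' n → Exec (.seq c d) S S'' (m + n)
  | loop_nil {a S} (c₀ c₁) : S a = [] → Exec (.loop a c₀ c₁) S S 1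
  | loop_cons {a c₀ c₁ S S' S'' b l m n} : S a = b :: l →
      Exec (cond b c₁ c₀) (update S a l) S' m → Exec (.loop a c₀ c₁) S' S'' n →
      Exec (.loop a c₀ c₁) S S'' (1 + m + n)
  | weaken {c S S' m n} : Exec c S S' m → m ≤ n → Exec c S S' n

/-- All stacks mentioned in the command have an index below `M`. -/
def Cmd.UsesBelow (M : ℕ) : Cmd → Prop
  | .prim a _ b => a < M ∧ b < M
  | .pop a => a < M
  | .seq c d => c.UsesBelow M ∧ d.UsesBelow M
  | .loop a c d => a < M ∧ c.UsesBelow M ∧ d.UsesBelow M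

theorem Cmd.UsesBelow.mono {M N : ℕ} (h : M ≤ N) : ∀ {c : Cmd}, c.UsesBelow M → c.UsesBelow N
  | .prim _ _ _, hc => ⟨hc.1.trans_le h, hc.2.trans_le h⟩
  | .pop _, hc => lt_of_lt_of_le (show _ < M from hc) h
  | .seq _ _, hc => ⟨hc.1.mono h, hc.2.mono h⟩
  | .loop _ _ _, hc => ⟨hc.1.trans_le h, hc.2.1.mono h, hc.2.2.mono h⟩

theorem Cmd.exists_usesBelow : ∀ c : Cmd, ∃ M, c.UsesBelow M
  | .prim a _ b => ⟨max a b + 1, by simp [UsesBelow]⟩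
  | .pop a => ⟨a + 1, Nat.lt_succ_self a⟩
  | .seq c d => by
    obtain ⟨M, hM⟩ := c.exists_usesBelow
    obtain ⟨N, hN⟩ := d.exists_usesBelow
    exact ⟨max M N, hM.mono (le_max_left _ _), hN.mono (le_max_right _ _)⟩
  | .loop a c d => by
    obtain ⟨M, hM⟩ := c.exists_usesBelow
    obtain ⟨N, hN⟩ := d.exists_usesBelow
    exact ⟨max (a + 1) (max M N), lt_of_lt_of_le (Nat.lt_succ_self a) (le_max_left _ _),
      hM.mono ((le_max_left _ _).trans (le_max_right _ _)),
      hN.mono ((le_max_right _ _).trans (le_max_right _ _))⟩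

/-! ### Compilation of commands into Turing machines -/

/-- The labels of the machine code of a command. -/
def Cmd.Label : Cmd → Type
  | .prim _ _ _ => Unit
  | .pop _ => Unit
  | .seq c d => c.Label ⊕ d.Label
  | .loop _ c d => Option (c.Label ⊕ d.Label)

theorem Cmd.finite_label : ∀ c : Cmd, Finite c.Label
  | .prim _ _ _ => inferInstanceAs (Finite Unit)
  | .pop _ => inferInstanceAs (Finite Unit)
  | .seq c d => by
    have := c.finite_label
    have := d.finite_label
    exact inferInstanceAs (Finite (c.Label ⊕ d.Label))
  | .loop _ c d => by
    have := c.finite_label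
    have := d.finite_label
    exact inferInstanceAs (Finite (Option (c.Label ⊕ d.Label)))

/-- The label at which the machine code of a command starts. -/
def Cmd.entry : (c : Cmd) → c.Label
  | .prim _ _ _ => ()
  | .pop _ => ()
  | .seq c _ => Sum.inl c.entry
  | .loop _ _ _ => none

open Turing.TM2.Stmt in
/-- The machine code of a command, inside a machine with labels `Λ` in which the labels of the
command are embedded by `emb`, and which continues at `exit` afterwards. The internal state of the
machine is the symbol it has read last. -/
def Cmd.compile (M : ℕ) {Λ : Type} : (c : Cmd) → (c.Label → Λ) → Λ → c.Label →
    Turing.TM2.Stmt (fun _ : Fin (M + 1) => Bool) Λ (Option Bool)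
  | .prim a f b, _, exit => fun _ =>
      peek (Fin.ofNat (M + 1) a) (fun _ o => o) <|
        branch (fun o => (f o).isSome)
          (push (Fin.ofNat (M + 1) b) (fun o => (f o).getD false) (goto fun _ => exit))
          (goto fun _ => exit)
  | .pop a, _, exit => fun _ =>
      Turing.TM2.Stmt.pop (Fin.ofNat (M + 1) a) (fun s _ => s) (goto fun _ => exit)
  | .seq c d, emb, exit => fun l =>
      Sum.elim (c.compile M (fun l => emb (Sum.inl l)) (emb (Sum.inr d.entry)))
        (d.compile M (fun l => emb (Sum.inr l)) exit) l
  | .loop a c d, emb, exit => fun l =>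
      Option.elim l
        (Turing.TM2.Stmt.pop (Fin.ofNat (M + 1) a) (fun _ o => o) <| goto fun o =>
          o.elim exit fun b => emb (some (cond b (Sum.inr d.entry) (Sum.inl c.entry))))
        (Sum.elim (c.compile M (fun l => emb (some (Sum.inl l))) (emb none))
          (d.compile M (fun l => emb (some (Sum.inr l))) (emb none)))

/-- The partial function `f` leads from `x` to `y` in at most `n` steps. -/
def StepsTo {α : Type*} (f : α → Option α) (x y : α) (n : ℕ) : Prop :=
  ∃ k ≤ n, (flip bind f)^[k] (some x) = some y

theorem StepsTo.trans {α : Type*} {f : α → Option α} {x y z : α} {m n : ℕ}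
    (h : StepsTo f x y m) (h' : StepsTo f y z n) : StepsTo f x z (m + n) := by
  obtain ⟨k, hk, e⟩ := h
  obtain ⟨k', hk', e'⟩ := h'
  refine ⟨k' + k, by omega, ?_⟩
  rw [Function.iterate_add_apply, e, e']

theorem StepsTo.single {α : Type*} {f : α → Option α} {x y : α} (h : f x = some y) :
    StepsTo f x y 1 := ⟨1, le_rfl, by simpa [flip] using h⟩

/-- The stacks with index at most `M`, as the stacks of a Turing machine. -/
def restrict (M : ℕ) (S : ℕ → List Bool) : Fin (M + 1) → List Bool := fun i => S i

theorem restrict_update {M a : ℕ} (ha : a < M + 1) (S : ℕ → List Bool) (l : List Bool) :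
    restrict M (update S a l) = update (restrict M S) (Fin.ofNat (M + 1) a) l := by
  funext i
  by_cases h : i = Fin.ofNat (M + 1) a
  · subst h
    simp [restrict, Nat.mod_eq_of_lt ha]
  · have h' : (i : ℕ) ≠ a := by
      rintro rfl
      exact h (by ext; simp)
    rw [update_of_ne h]
    simp [restrict, h']

theorem restrict_ofNat {M a : ℕ} (ha : a < M + 1) (S : ℕ → List Bool) :
    restrict M S (Fin.ofNat (M + 1) a) = S a := by
  simp [restrict, Nat.mod_eq_of_lt ha]

/-- The machine code of a command does what the command does, within the same time. -/
theorem Exec.stepsTo {M : ℕ} {Λ : Type}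
    (m : Λ → Turing.TM2.Stmt (fun _ : Fin (M + 1) => Bool) Λ (Option Bool))
    {c : Cmd} {S S' : ℕ → List Bool} {n : ℕ} (h : Exec c S S' n) :
    c.UsesBelow (M + 1) → ∀ (emb : c.Label → Λ) (exit : Λ),
      (∀ l, m (emb l) = c.compile M emb exit l) → ∀ o : Option Bool, ∃ o' : Option Bool,
        StepsTo (Turing.TM2.step m) ⟨some (emb c.entry), o, restrict M S⟩
          ⟨some exit, o', restrict M S'⟩ n := by
  induction h with
  | prim a f b S =>
    intro hc emb exit hm o
    refine ⟨(S a).head?, StepsTo.single ?_⟩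
    simp only [Turing.TM2.step, hm, Cmd.compile, Turing.TM2.stepAux, restrict_ofNat hc.1,
      restrict_ofNat hc.2, restrict_update hc.2]
    cases hf : f (S a).head? <;> simp [← restrict_ofNat hc.2 S]
  | pop a S =>
    intro hc emb exit hm o
    have hc : a < M + 1 := hc
    refine ⟨o, StepsTo.single ?_⟩
    simp only [Turing.TM2.step, hm, Cmd.compile, Turing.TM2.stepAux, restrict_ofNat hc,
      restrict_update hc]
  | @seq c d S S' S'' k n _ _ ih₁ ih₂ =>
    intro hc emb exit hm o
    obtain ⟨o₁, h₁⟩ := ih₁ hc.1 (fun l => emb (Sum.inl l)) (emb (Sum.inr d.entry))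
      (fun l => hm (Sum.inl l)) o
    obtain ⟨o₂, h₂⟩ := ih₂ hc.2 (fun l => emb (Sum.inr l)) exit (fun l => hm (Sum.inr l)) o₁
    exact ⟨o₂, h₁.trans h₂⟩
  | @loop_nil a S c₀ c₁ ha =>
    intro hc emb exit hm o
    refine ⟨none, StepsTo.single ?_⟩
    have hm0 := hm (Cmd.entry (.loop a c₀ c₁))
    simp only [Turing.TM2.step, hm0]
    simp only [Cmd.compile, Cmd.entry, Turing.TM2.stepAux, restrict_ofNat hc.1, Option.elim, ha,
      List.head?_nil, List.tail_nil]
    rw [← ha, ← restrict_ofNat hc.1 S, update_eq_self]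
  | @loop_cons a c₀ c₁ S S' S'' b l k n ha _ _ ih₁ ih₂ =>
    intro hc emb exit hm o
    have h₀ : StepsTo (Turing.TM2.step m) ⟨some (emb (Cmd.entry (.loop a c₀ c₁))), o, restrict M S⟩
        ⟨some (emb (some (cond b (Sum.inr c₁.entry) (Sum.inl c₀.entry)))), some b,
          restrict M (update S a l)⟩ 1 := by
      refine StepsTo.single ?_
      have hm0 := hm (Cmd.entry (.loop a c₀ c₁))
      simp only [Turing.TM2.step, hm0]
      simp only [Cmd.compile, Cmd.entry, Turing.TM2.stepAux, restrict_ofNat hc.1, Option.elim, ha,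
        List.head?_cons, List.tail_cons, restrict_update hc.1]
    have h₁ : ∃ o', StepsTo (Turing.TM2.step m)
        ⟨some (emb (some (cond b (Sum.inr c₁.entry) (Sum.inl c₀.entry)))), some b,
          restrict M (update S a l)⟩
        ⟨some (emb (Cmd.entry (.loop a c₀ c₁))), o', restrict M S'⟩ k := by
      cases b
      · exact ih₁ hc.2.1 (fun l => emb (some (Sum.inl l))) (emb none)
          (fun l => hm (some (Sum.inl l))) _
      · exact ih₁ hc.2.2 (fun l => emb (some (Sum.inr l))) (emb none)
          (fun l => hm (some (Sum.inr l))) _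
    obtain ⟨o₁, h₁⟩ := h₁
    obtain ⟨o₂, h₂⟩ := ih₂ hc emb exit hm o₁
    exact ⟨o₂, (h₀.trans h₁).trans h₂⟩
  | weaken _ hle ih =>
    intro hc emb exit hm o
    obtain ⟨o', k, hk, e⟩ := ih hc emb exit hm o
    exact ⟨o', k, hk.trans hle, e⟩

open Classical in
/-- A language is in P if some command turns, in polynomial time, the stack `0` holding the input
into the stack `1` holding the answer, all other stacks being empty before and after. -/
theorem inP_of_exec {L : Set (List Bool)} (c : Cmd) (P : Polynomial ℕ)
    (h : ∀ w : List Bool, Exec c (update (fun _ => []) 0 w)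
      (update (fun _ => []) 1 [decide (w ∈ L)]) (P.eval w.length)) : InP L := by
  obtain ⟨M₀, hM₀⟩ := c.exists_usesBelow
  obtain ⟨M, hM1, hM⟩ : ∃ M, 1 < M + 1 ∧ c.UsesBelow (M + 1) :=
    ⟨M₀ + 1, by omega, hM₀.mono (by omega)⟩
  have := c.finite_label
  have : Fintype c.Label := Fintype.ofFinite _
  let m : Option c.Label → Turing.TM2.Stmt (fun _ : Fin (M + 1) => Bool) (Option c.Label)
      (Option Bool) := fun l =>
    l.elim (.load (fun _ => none) .halt) (c.compile M some none)
  let tm : Turing.FinTM2 :=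
    { K := Fin (M + 1)
      k₀ := Fin.ofNat (M + 1) 0
      k₁ := Fin.ofNat (M + 1) 1
      Γ := fun _ => Bool
      Λ := Option c.Label
      main := some c.entry
      σ := Option Bool
      initialState := none
      Γk₀Fin := inferInstanceAs (Fintype Bool)
      m := m }
  have key : ∀ w : List Bool, StepsTo (Turing.TM2.step m)
      ⟨some (some c.entry), none, restrict M (update (fun _ => []) 0 w)⟩
      ⟨none, none, restrict M (update (fun _ => []) 1 [decide (w ∈ L)])⟩
      (P.eval w.length + 1) := by
    intro w
    obtain ⟨o, ho⟩ := (h w).stepsTo m hM some none (fun _ => rfl) none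
    exact ho.trans (StepsTo.single rfl)
  refine ⟨⟨⟨tm, Equiv.refl _, Equiv.refl _⟩, P + 1, fun w => ?_⟩⟩
  have e₀ : Turing.initList tm (List.map (Equiv.refl Bool).invFun (id w)) =
      (⟨some (some c.entry), none, restrict M (update (fun _ => []) 0 w)⟩ :
        Turing.TM2.Cfg (fun _ : Fin (M + 1) => Bool) (Option c.Label) (Option Bool)) := by
    rw [restrict_update (by omega)]
    simp only [Turing.initList, tm, Equiv.refl, id]
    congr 1
    funext k
    by_cases hk : k = Fin.ofNat (M + 1) 0
    · subst hk; simp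
    · rw [update_of_ne hk]
      exact dif_neg hk
  have e₁ : Turing.haltList tm (List.map (Equiv.refl Bool).invFun
      (Computability.encodeBool (decide (w ∈ L)))) =
      (⟨none, none, restrict M (update (fun _ => []) 1 [decide (w ∈ L)])⟩ :
        Turing.TM2.Cfg (fun _ : Fin (M + 1) => Bool) (Option c.Label) (Option Bool)) := by
    rw [restrict_update hM1]
    simp only [Turing.haltList, tm, Equiv.refl, Computability.encodeBool]
    congr 1
    funext k
    by_cases hk : k = Fin.ofNat (M + 1) 1
    · subst hk; simp
    · rw [update_of_ne hk]
      exact dif_neg hk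
  choose k hk e using key
  refine ⟨⟨k w, ?_⟩, ?_⟩
  · have := e w
    rw [← e₀, ← e₁] at this
    exact this
  · simpa using hk w

theorem Exec.congr {c : Cmd} {S S' R R' : ℕ → List Bool} {m n : ℕ} (h : Exec c S S' m)
    (hS : S = R) (hS' : S' = R') (hmn : m ≤ n) : Exec c R R' n := by
  subst hS hS'
  exact h.weaken hmn

/-! ### Building blocks for commands -/

namespace Cmd

/-- Push the bit `b` on stack `a`. -/
def push (a : ℕ) (b : Bool) : Cmd := .prim a (fun _ => some b) a

/-- Empty the stack `a`. -/
def clear (a : ℕ) : Cmd := .loop a (.prim a (fun _ => none) a) (.prim a (fun _ => none) a)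

/-- Empty stack `a` and push as many bits on `b`. -/
def addTo (a b : ℕ) : Cmd := .loop a (push b true) (push b true)

/-- Put on stack `b` as many bits as there are on stack `a`, using `s` as auxiliary stack. -/
def copyLength (a b s : ℕ) : Cmd :=
  .seq (.loop a (.seq (push b true) (push s false)) (.seq (push b true) (push s true)))
    (.loop s (push a false) (push a true))

end Cmd

theorem exec_push (a : ℕ) (b : Bool) (S : ℕ → List Bool) :
    Exec (.push a b) S (update S a (b :: S a)) 1 := Exec.prim a (fun _ => some b) a S

theorem exec_clear (a : ℕ) (l : List Bool) :
    ∀ S : ℕ → List Bool, S a = l → Exec (.clear a) S (update S a []) (2 * l.length + 1) := by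
  induction l with
  | nil =>
    intro S hS
    exact (Exec.loop_nil _ _ hS).congr rfl (by rw [← hS, update_eq_self]) (by simp)
  | cons b l ih =>
    intro S hS
    have h := ih (update S a l) (by simp)
    refine (Exec.loop_cons (b := b) (l := l) (m := 1) hS ?_ h).congr rfl (by simp) ?_
    · cases b <;> exact (Exec.prim a (fun _ => none) a _).congr rfl (by simp) le_rfl
    · simp; omega

theorem exec_addTo {a b : ℕ} (hab : a ≠ b) (l : List Bool) :
    ∀ S : ℕ → List Bool, S a = l → Exec (.addTo a b) S
      (update (update S a []) b (List.replicate l.length true ++ S b)) (2 * l.length + 1) := by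
  induction l with
  | nil =>
    intro S hS
    refine (Exec.loop_nil _ _ hS).congr rfl ?_ (by simp)
    funext r
    simp only [update_apply]
    split_ifs <;> simp_all
  | cons x l ih =>
    intro S hS
    have h := ih (update (update S a l) b (true :: S b)) (by simp [hab])
    refine (Exec.loop_cons (b := x) (l := l) (m := 1) hS ?_ h).congr rfl ?_ (n := _) ?_
    · cases x <;> exact (exec_push b true _).congr rfl (by simp [hab.symm]) le_rfl
    · funext r
      simp only [update_apply, List.length_cons, List.replicate_succ']
      split_ifs <;> simp_all
    · simp; omega

/-- Moving the contents of a stack `s` to `a` bit by bit reverses it. -/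
theorem exec_moveAll {s a : ℕ} (hsa : s ≠ a) (l : List Bool) :
    ∀ S : ℕ → List Bool, S s = l → Exec (.loop s (.push a false) (.push a true)) S
      (update (update S s []) a (l.reverse ++ S a)) (2 * l.length + 1) := by
  induction l with
  | nil =>
    intro S hS
    refine (Exec.loop_nil _ _ hS).congr rfl ?_ (by simp)
    funext r
    simp only [update_apply]
    split_ifs <;> simp_all
  | cons x l ih =>
    intro S hS
    have h := ih (update (update S s l) a (x :: S a)) (by simp [hsa])
    refine (Exec.loop_cons (b := x) (l := l) (m := 1) hS ?_ h).congr rfl ?_ (n := _) ?_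
    · cases x <;> exact (exec_push a _ _).congr rfl (by simp [hsa.symm]) le_rfl
    · funext r
      simp only [update_apply, List.reverse_cons]
      split_ifs <;> simp_all
    · simp; omega

theorem exec_copyLength {a b s : ℕ} (hab : a ≠ b) (has : a ≠ s) (hbs : b ≠ s)
    (S : ℕ → List Bool) (hb : S b = []) (hs : S s = []) :
    Exec (.copyLength a b s) S (update S b (List.replicate (S a).length true))
      (5 * (S a).length + 2) := by
  have key : ∀ l : List Bool, ∀ S : ℕ → List Bool, S a = l →
      Exec (.loop a (.seq (.push b true) (.push s false)) (.seq (.push b true) (.push s true))) S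
        (update (update (update S a []) b (List.replicate l.length true ++ S b)) s
          (l.reverse ++ S s)) (3 * l.length + 1) := by
    intro l
    induction l with
    | nil =>
      intro S hS
      refine (Exec.loop_nil _ _ hS).congr rfl ?_ (by simp)
      funext r
      simp only [update_apply]
      split_ifs <;> simp_all
    | cons x l ih =>
      intro S hS
      have h := ih (update (update (update S a l) b (true :: S b)) s (x :: S s))
        (by simp [hab, has])
      refine (Exec.loop_cons (b := x) (l := l) (m := 2) hS ?_ h).congr rfl ?_ (n := _) ?_
      · cases x <;> refine ((exec_push b true _).seq (exec_push s _ _)).congr rfl ?_ le_rfl <;>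
          simp [hab.symm, has.symm, hbs.symm]
      · funext r
        simp only [update_apply, List.length_cons, List.replicate_succ', List.reverse_cons]
        split_ifs <;> simp_all
      · simp; omega
  have h := (key (S a) S rfl).seq (exec_moveAll has.symm (S a).reverse _ (by simp [hs]))
  refine h.congr rfl ?_ (by simp; omega)
  funext r
  simp only [update_apply]
  split_ifs <;> simp_all

/-- A loop over a stack used as a counter; `F j` are the stacks after `j` rounds. -/
theorem Exec.loop_replicate {a : ℕ} {c₀ c : Cmd} {T : ℕ} (n : ℕ) :
    ∀ F : ℕ → ℕ → List Bool, (∀ j ≤ n, F j a = List.replicate (n - j) true) →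
      (∀ j < n, Exec c (update (F j) a (List.replicate (n - j - 1) true)) (F (j + 1)) T) →
      Exec (.loop a c₀ c) (F 0) (F n) (n * (T + 1) + 1) := by
  induction n with
  | zero =>
    intro F h _
    exact (Exec.loop_nil _ _ (by simpa using h 0 le_rfl)).weaken (by omega)
  | succ n ih =>
    intro F h h'
    have h₁ := ih (fun j => F (j + 1)) (fun j hj => by rw [h _ (by omega)]; congr 1; omega)
      (fun j hj => by
        have := h' (j + 1) (by omega)
        rwa [show n + 1 - (j + 1) - 1 = n - j - 1 by omega] at this)
    have h₀ := h' 0 (by omega)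
    refine (Exec.loop_cons (b := true) (l := List.replicate n true)
      (by simp [h 0, List.replicate_succ]) h₀ h₁).weaken ?_
    rw [Nat.succ_mul]
    omega

/-! ### Arithmetic expressions evaluated in polynomial time -/

/-- Arithmetic expressions about a binary string, in variables named by natural numbers. They are
built from `1`, variables, the length of the string, its bits, sums, truncated differences and
bounded summation. -/
inductive Expr : Type
  | one
  | var (i : ℕ)
  | len
  | bit (e : Expr)
  | add (a b : Expr)
  | tsub (a b : Expr)
  /-- The sum of `e` over all values less than `b` of the variable `i`. -/
  | sum (i : ℕ) (b e : Expr)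

/-- The value of an expression for a string `w` and values `v` of the variables. The value of
`bit e` is `1` if the bit of `w` at position `e` exists and is set, and `0` otherwise. -/
def Expr.eval (w : List Bool) : Expr → (ℕ → ℕ) → ℕ
  | .one, _ => 1
  | .var i, v => v i
  | .len, _ => w.length
  | .bit e, v => if w[e.eval w v]? = some true then 1 else 0
  | .add a b, v => a.eval w v + b.eval w v
  | .tsub a b, v => a.eval w v - b.eval w v
  | .sum i b e, v => ∑ x ∈ Finset.range (b.eval w v), e.eval w (update v i x)

/-- A command evaluating an expression. The input string is on stack `0`; numbers are stored in
unary on stacks, the variable `i` on stack `ρ i`. The stacks from `d` on are free, and the result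
is left on stack `d`.

To look up a bit, the input is moved to stack `d + 2` up to the position in question and moved back
afterwards. For a sum, stack `d` holds the sum so far, stack `d + 1` the current value of the
variable, and stack `d + 2` the number of rounds that remain. -/
def Expr.compile : Expr → (ℕ → ℕ) → ℕ → Cmd
  | .one, _, d => .push d true
  | .var i, ρ, d => .copyLength (ρ i) d (d + 1)
  | .len, _, d => .copyLength 0 d (d + 1)
  | .bit e, ρ, d =>
      .seq (e.compile ρ (d + 1)) <|
      .seq (.loop (d + 1) (.pop (d + 1)) (.seq (.prim 0 id (d + 2)) (.pop 0))) <|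
      .seq (.prim 0 (fun o => if o = some true then some true else none) d) <|
      .loop (d + 2) (.push 0 false) (.push 0 true)
  | .add a b, ρ, d => .seq (a.compile ρ d) <| .seq (b.compile ρ (d + 1)) <| .addTo (d + 1) d
  | .tsub a b, ρ, d =>
      .seq (a.compile ρ d) <| .seq (b.compile ρ (d + 1)) <| .loop (d + 1) (.pop d) (.pop d)
  | .sum i b e, ρ, d =>
      .seq (b.compile ρ (d + 2)) <|
      .seq (.loop (d + 2) (.pop (d + 2)) <|
        .seq (e.compile (update ρ i (d + 1)) (d + 3)) <|
        .seq (.addTo (d + 3) d) (.push (d + 1) true)) <|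
      .clear (d + 1)

/-- The polynomial `P` bounds the value and the evaluation time of `e` in terms of a bound `B` on the
length of the input and on the values of the variables. -/
def Expr.BoundedBy (e : Expr) (P : Polynomial ℕ) : Prop :=
  ∀ (B : ℕ) (w : List Bool) (v : ℕ → ℕ), w.length ≤ B → (∀ i, v i ≤ B) → e.eval w v ≤ P.eval B ∧
    ∀ (ρ : ℕ → ℕ) (d : ℕ) (S : ℕ → List Bool), S 0 = w → 0 < d →
      (∀ i, ρ i < d ∧ S (ρ i) = List.replicate (v i) true) → (∀ r, d ≤ r → S r = []) →
      Exec (e.compile ρ d) S (update S d (List.replicate (e.eval w v) true)) (P.eval B)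

theorem Expr.BoundedBy.one :
    Expr.one.BoundedBy 1 := by
  refine fun B w v _ _ => ⟨by simp [eval], fun ρ d S _ _ _ hd => ?_⟩
  exact (exec_push d true S).congr rfl (by simp [hd d le_rfl, eval]) (by simp)

theorem Expr.BoundedBy.var (i : ℕ) :
    (Expr.var i).BoundedBy (5 * Polynomial.X + 2) := by
  refine fun B w v _ hv => ⟨?_, fun ρ d S _ _ hρ hd => ?_⟩
  · have := hv i
    simp [eval]; omega
  · have h := exec_copyLength (a := ρ i) (b := d) (s := d + 1) (hρ i).1.ne
      ((hρ i).1.trans (Nat.lt_succ_self d)).ne (by simp) S (hd _ le_rfl) (hd _ (by simp))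
    refine h.congr rfl (by simp [(hρ i).2, eval]) ?_
    have := hv i
    simp [(hρ i).2]; omega

theorem Expr.BoundedBy.len :
    Expr.len.BoundedBy (5 * Polynomial.X + 2) := by
  refine fun B w v hw _ => ⟨?_, fun ρ d S h0 hd0 _ hd => ?_⟩
  · simp [eval]; omega
  · have h := exec_copyLength (a := 0) (b := d) (s := d + 1) hd0.ne
      (by simp) (by simp) S (hd _ le_rfl) (hd _ (by simp))
    refine h.congr rfl (by simp [h0, eval]) ?_
    simp [h0]; omega

theorem Expr.BoundedBy.bit {e : Expr} {P : Polynomial ℕ} (hP : e.BoundedBy P) :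
    (Expr.bit e).BoundedBy (6 * P + 5 + 2 * Polynomial.X) := by
  refine fun B w v hw hv => ⟨?_, fun ρ d S h0 hd0 hρ hd => ?_⟩
  · simp only [eval]
    split_ifs <;> simp; omega
  obtain ⟨hb, hx⟩ := hP B w v hw hv
  have h₁ := hx ρ (d + 1) S h0 (by omega) (fun i => ⟨(hρ i).1.trans (Nat.lt_succ_self d),
    (hρ i).2⟩) (fun r hr => hd r (by omega))
  set n := e.eval w v
  have h₂ : Exec (.loop (d + 1) (.pop (d + 1)) (.seq (.prim 0 id (d + 2)) (.pop 0)))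
      (update S (d + 1) (List.replicate n true))
      (update (update S 0 (w.drop n)) (d + 2) (w.take n).reverse) (n * (2 + 1) + 1) := by
    have h := Exec.loop_replicate (a := d + 1) (c₀ := .pop (d + 1))
      (c := .seq (.prim 0 id (d + 2)) (.pop 0)) (T := 2) n
      (fun j => update (update (update S 0 (w.drop j)) (d + 2) (w.take j).reverse) (d + 1)
        (List.replicate (n - j) true)) (fun j _ => by simp) ?_
    · refine h.congr ?_ ?_ le_rfl
      · funext r
        have := hd (d + 2) (by omega)
        clear * - this h0 hd0
        simp only [update_apply]
        split_ifs <;> simp_all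
      · funext r
        have := hd (d + 1) (by omega)
        clear * - this h0 hd0
        simp only [update_apply]
        split_ifs <;> simp_all
    · intro j hj
      refine ((Exec.prim 0 id (d + 2) _).seq (Exec.pop 0 _)).congr rfl ?_ le_rfl
      clear * - hd0
      funext r
      simp only [update_apply]
      split_ifs <;> first | omega | skip
      all_goals simp_all [Nat.sub_sub, List.take_add_one]
      cases w[j]? <;> rfl
  have h₃ := Exec.prim 0 (fun o => if o = some true then some true else none) d
    (update (update S 0 (w.drop n)) (d + 2) (w.take n).reverse)
  have h₄ := exec_moveAll (s := d + 2) (a := 0) (by omega) (w.take n).reverse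
    (update (update (update S 0 (w.drop n)) (d + 2) (w.take n).reverse) d
      (List.replicate (Expr.eval w (.bit e) v) true)) (by simp)
  have h₃' : Exec (.prim 0 (fun o => if o = some true then some true else none) d)
      (update (update S 0 (w.drop n)) (d + 2) (w.take n).reverse)
      (update (update (update S 0 (w.drop n)) (d + 2) (w.take n).reverse) d
        (List.replicate (Expr.eval w (.bit e) v) true)) 1 := by
    refine h₃.congr rfl ?_ le_rfl
    have := hd d le_rfl
    congr 1
    simp only [eval]
    simp [hd0.ne', this, n]
    split_ifs <;> simp
  refine (h₁.seq (h₂.seq (h₃'.seq h₄))).congr rfl ?_ ?_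
  · funext r
    have := hd (d + 2) (by omega)
    clear * - this h0 hd0
    simp only [update_apply]
    split_ifs <;> simp_all
  · simp; omega

theorem Expr.BoundedBy.add {a b : Expr} {P Q : Polynomial ℕ} (hP : a.BoundedBy P)
    (hQ : b.BoundedBy Q) :
    (Expr.add a b).BoundedBy (P + 3 * Q + 1) := by
  intro B w v hw hv
  obtain ⟨ha, hxa⟩ := hP B w v hw hv
  obtain ⟨hb, hxb⟩ := hQ B w v hw hv
  refine ⟨by simp [eval]; omega, fun ρ d S h0 hd0 hρ hd => ?_⟩
  have h₁ := hxa ρ d S h0 hd0 hρ hd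
  have h₂ := hxb ρ (d + 1) (update S d (List.replicate (a.eval w v) true))
    (by simp [hd0.ne, h0]) (by omega)
    (fun i => ⟨(hρ i).1.trans (Nat.lt_succ_self d), by simp [(hρ i).1.ne, (hρ i).2]⟩)
    (fun r hr => by rw [update_of_ne (by omega)]; exact hd r (by omega))
  have h₃ := exec_addTo (a := d + 1) (b := d) (by omega) (List.replicate (b.eval w v) true)
    (update (update S d (List.replicate (a.eval w v) true)) (d + 1)
      (List.replicate (b.eval w v) true)) (by simp)
  refine (h₁.seq (h₂.seq h₃)).congr rfl ?_ ?_
  · funext r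
    have := hd (d + 1) (by omega)
    clear * - this
    simp only [update_apply, eval]
    split_ifs <;> first | omega | (subst_vars; simp_all [Nat.add_comm])
  · simp; omega

theorem Expr.BoundedBy.tsub {a b : Expr} {P Q : Polynomial ℕ} (hP : a.BoundedBy P)
    (hQ : b.BoundedBy Q) :
    (Expr.tsub a b).BoundedBy (P + 3 * Q + 1) := by
  intro B w v hw hv
  obtain ⟨ha, hxa⟩ := hP B w v hw hv
  obtain ⟨hb, hxb⟩ := hQ B w v hw hv
  refine ⟨by simp [eval]; omega, fun ρ d S h0 hd0 hρ hd => ?_⟩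
  have h₁ := hxa ρ d S h0 hd0 hρ hd
  have h₂ := hxb ρ (d + 1) (update S d (List.replicate (a.eval w v) true))
    (by simp [hd0.ne, h0]) (by omega)
    (fun i => ⟨(hρ i).1.trans (Nat.lt_succ_self d), by simp [(hρ i).1.ne, (hρ i).2]⟩)
    (fun r hr => by rw [update_of_ne (by omega)]; exact hd r (by omega))
  have h₃ := Exec.loop_replicate (a := d + 1) (c₀ := .pop d) (c := .pop d) (T := 1)
    (b.eval w v) (fun j => update (update S d (List.replicate (a.eval w v - j) true)) (d + 1)
      (List.replicate (b.eval w v - j) true)) (fun j _ => by simp) (fun j hj => by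
        refine (Exec.pop d _).congr rfl ?_ le_rfl
        funext r
        simp only [update_apply]
        clear * -
        split_ifs <;> first | omega | (subst_vars; simp [Nat.sub_sub]))
  refine (h₁.seq (h₂.seq h₃)).congr rfl ?_ ?_
  · funext r
    have := hd (d + 1) (by omega)
    clear * - this
    simp only [update_apply, eval]
    split_ifs <;> simp_all
  · simp; omega

theorem Expr.BoundedBy.sum (i : ℕ) {b e : Expr} {P Q : Polynomial ℕ} (hP : b.BoundedBy P)
    (hQ : e.BoundedBy Q) :
    (Expr.sum i b e).BoundedBy (3 * P + P * (3 * Q.comp (Polynomial.X + P) + 3) + 2) := by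
  intro B w v hw hv
  obtain ⟨hb, hxb⟩ := hP B w v hw hv
  set n := b.eval w v with hn
  -- the summation variable is below `n ≤ P B`, so `B + P B` bounds all variables of the summand
  set T := Q.eval (B + P.eval B)
  have hbody : ∀ j < n, e.eval w (update v i j) ≤ T ∧ _ := fun j hj =>
    hQ (B + P.eval B) w (update v i j) (by omega) (fun k => by
      rw [update_apply]
      split_ifs
      · omega
      · exact (hv k).trans (Nat.le_add_right _ _))
  have hmul : n * T ≤ P.eval B * T := Nat.mul_le_mul_right _ hb
  constructor
  · have : ∑ x ∈ Finset.range n, e.eval w (update v i x) ≤ n * T := by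
      simpa using Finset.sum_le_card_nsmul (Finset.range n) _ T
        (fun x hx => (hbody x (Finset.mem_range.1 hx)).1)
    simp only [eval, ← hn]
    simp only [Polynomial.eval_add, Polynomial.eval_mul, Polynomial.eval_comp,
      Polynomial.eval_X, Polynomial.eval_ofNat]
    change _ ≤ 3 * P.eval B + P.eval B * (3 * T + 3) + 2
    nlinarith
  intro ρ d S h0 hd0 hρ hd
  have h₁ := hxb ρ (d + 2) S h0 (by omega) (fun i => ⟨(hρ i).1.trans (by omega), (hρ i).2⟩)
    (fun r hr => hd r (by omega))
  have h₂ := Exec.loop_replicate (a := d + 2) (c₀ := .pop (d + 2))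
    (c := .seq (e.compile (update ρ i (d + 1)) (d + 3))
      (.seq (.addTo (d + 3) d) (.push (d + 1) true))) (T := 3 * T + 2) n
    (fun j => update (update (update S d (List.replicate
      (∑ x ∈ Finset.range j, e.eval w (update v i x)) true)) (d + 1) (List.replicate j true))
      (d + 2) (List.replicate (n - j) true)) (fun j _ => by simp) (fun j hj => by
        obtain ⟨hle, hx⟩ := hbody j hj
        have g₁ := hx (update ρ i (d + 1)) (d + 3)
          (update (update (update S d (List.replicate
            (∑ x ∈ Finset.range j, e.eval w (update v i x)) true)) (d + 1)
            (List.replicate j true)) (d + 2) (List.replicate (n - j - 1) true))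
          (by simp [hd0.ne, h0]) (by omega)
          (fun k => by
            by_cases hk : k = i
            · subst hk; simp
            · have := (hρ k).1
              simp only [update_of_ne hk]
              refine ⟨by omega, ?_⟩
              rw [update_of_ne (by omega), update_of_ne (by omega), update_of_ne (by omega)]
              exact (hρ k).2)
          (fun r hr => by
            rw [update_of_ne (by omega), update_of_ne (by omega), update_of_ne (by omega)]
            exact hd r (by omega))
        have g₂ := exec_addTo (a := d + 3) (b := d) (by omega)
          (List.replicate (e.eval w (update v i j)) true) _
          (by rw [update_self] : update (update (update (update S d (List.replicate
            (∑ x ∈ Finset.range j, e.eval w (update v i x)) true)) (d + 1)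
            (List.replicate j true)) (d + 2) (List.replicate (n - j - 1) true)) (d + 3)
            (List.replicate (e.eval w (update v i j)) true) (d + 3) = _)
        have g := g₁.seq (g₂.seq (exec_push (d + 1) true _))
        refine g.congr (by simp) ?_ ?_
        · funext r
          have := hd (d + 3) (by omega)
          clear * - this
          simp only [update_apply, Finset.sum_range_succ]
          split_ifs <;> first
            | omega
            | (subst_vars; simp [this, Nat.sub_sub, Nat.add_comm, List.replicate_succ])
        · simp; omega)
  have h₃ := exec_clear (d + 1) (List.replicate n true) _
    (by rw [update_of_ne (by omega), update_self] : (update (update (update S d (List.replicate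
      (∑ x ∈ Finset.range n, e.eval w (update v i x)) true)) (d + 1) (List.replicate n true))
      (d + 2) (List.replicate (n - n) true)) (d + 1) = _)
  refine (h₁.seq ((h₂.congr ?_ rfl le_rfl).seq h₃)).congr rfl ?_ ?_
  · funext r
    have h1 := hd (d + 1) (by omega)
    have := hd d (by omega)
    clear * - this h1
    simp only [update_apply]
    split_ifs <;> simp_all
  · funext r
    have h1 := hd (d + 1) (by omega)
    have := hd (d + 2) (by omega)
    clear * - this h1
    simp only [update_apply, eval]
    split_ifs <;> simp_all [n]
  · simp only [Polynomial.eval_add, Polynomial.eval_mul, Polynomial.eval_comp,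
      Polynomial.eval_X, Polynomial.eval_ofNat, List.length_replicate]
    change _ ≤ 3 * P.eval B + P.eval B * (3 * T + 3) + 2
    nlinarith

/-- Expressions are evaluated in polynomial time. -/
theorem Expr.exists_boundedBy : ∀ e : Expr, ∃ P, e.BoundedBy P
  | .one => ⟨_, .one⟩
  | .var i => ⟨_, .var i⟩
  | .len => ⟨_, .len⟩
  | .bit e => let ⟨_, h⟩ := e.exists_boundedBy; ⟨_, h.bit⟩
  | .add a b => let ⟨_, h⟩ := a.exists_boundedBy; let ⟨_, h'⟩ := b.exists_boundedBy; ⟨_, h.add h'⟩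
  | .tsub a b => let ⟨_, h⟩ := a.exists_boundedBy; let ⟨_, h'⟩ := b.exists_boundedBy; ⟨_, h.tsub h'⟩
  | .sum i b e =>
    let ⟨_, h⟩ := b.exists_boundedBy; let ⟨_, h'⟩ := e.exists_boundedBy; ⟨_, h.sum i h'⟩

/-- A language defined by an arithmetic expression is in P. -/
theorem inP_of_expr (e : Expr) : InP {w | e.eval w (fun _ => 0) ≠ 0} := by
  classical
  obtain ⟨P, hP⟩ := e.exists_boundedBy
  -- all variables start at `0`, so that the empty stack `2` can serve for all of them
  refine inP_of_exec (.seq (e.compile (fun _ => 2) 3) (.seq (.prim 3 (fun o => some o.isSome) 1)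
    (.seq (.clear 3) (.clear 0)))) (3 * P + 2 * Polynomial.X + 3) fun w => ?_
  obtain ⟨hle, hx⟩ := hP w.length w (fun _ => 0) le_rfl (fun _ => Nat.zero_le _)
  have h₁ := hx (fun _ => 2) 3 (update (fun _ => []) 0 w) (by simp) (by simp) (by simp)
    (fun r hr => by rw [update_of_ne (by omega)])
  set n := e.eval w (fun _ => 0) with hn
  have h₂ := h₁.seq ((Exec.prim 3 (fun o => some o.isSome) 1 _).seq
    ((exec_clear 3 (List.replicate n true) _ (by simp)).seq (exec_clear 0 w _ (by simp))))
  refine h₂.congr rfl ?_ (by simp; omega)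
  funext r
  have : decide (w ∈ {w : List Bool | e.eval w (fun _ => 0) ≠ 0}) =
      (List.replicate n true).head?.isSome := by
    rw [Bool.eq_iff_iff]
    simp only [Set.mem_ofPred_eq, decide_eq_true_eq, ← hn]
    cases n <;> simp [List.replicate_succ]
  simp only [update_apply]
  split_ifs <;> simp_all

/-! ### Counting the components of `G - S` -/

section Graph

variable {V : Type*} [Fintype V]

/-- `ω(G - S)`: the number of components that remain after deleting `S`. -/
noncomputable def omega (G : SimpleGraph V) (S : Finset V) : ℕ := numComponents (removeVerts G S)

instance finite_components (G : SimpleGraph V) (S : Finset V) :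
    Finite (removeVerts G S).ConnectedComponent :=
  Finite.of_surjective (removeVerts G S).connectedComponentMk (fun c => c.exists_rep)

theorem isCutset_iff (G : SimpleGraph V) (S : Finset V) : IsCutset G S ↔ 2 ≤ omega G S := by
  rw [IsCutset, omega, numComponents, ← not_lt, not_iff_not, Nat.lt_succ_iff,
    Finite.card_le_one_iff_subsingleton]
  exact ⟨fun h => h.subsingleton_connectedComponent, fun _ x y =>
    SimpleGraph.ConnectedComponent.eq.1 (Subsingleton.elim _ _)⟩

theorem isTough_iff {G : SimpleGraph V} {t : ℝ} (ht : 0 < t) :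
    IsTough G t ↔ ∀ S : Finset V, 2 ≤ omega G S → t * omega G S ≤ S.card := by
  unfold IsTough
  refine forall_congr' fun S => ?_
  rw [isCutset_iff, le_div_iff₀ ht, mul_comm, omega]

theorem removeVerts_reachable {V : Type*} {G : SimpleGraph V} {S : Finset V} {x y : V}
    (hx : x ∈ ((S : Set V)ᶜ)) (hy : y ∈ ((S : Set V)ᶜ)) (h : G.Adj x y) :
    (removeVerts G S).Reachable ⟨x, hx⟩ ⟨y, hy⟩ :=
  SimpleGraph.Adj.reachable (G := removeVerts G S) (u := ⟨x, hx⟩) (v := ⟨y, hy⟩) h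

theorem reachable_of_adj {W : Type*} {G H : SimpleGraph W}
    (h : ∀ x y, G.Adj x y → H.Reachable x y) {x y : W} (hxy : G.Reachable x y) :
    H.Reachable x y := by
  obtain ⟨p⟩ := hxy
  induction p with
  | nil => rfl
  | cons hadj _ ih => exact (h _ _ hadj).trans ih

/-- Vertices of `G - S` distinguished by a function that is constant on components lie in different
components. -/
theorem card_le_omega {α : Type*} {G : SimpleGraph V} {S R : Finset V} (f : V → α)
    (hf : ∀ x y, x ∉ S → y ∉ S → G.Adj x y → f x = f y) (hR : ∀ x ∈ R, x ∉ S)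
    (hinj : Set.InjOn f R) : R.card ≤ omega G S := by
  have hreach : ∀ x y, (removeVerts G S).Reachable x y → f x = f y := by
    rintro x y ⟨p⟩
    induction p with
    | nil => rfl
    | @cons a b c hadj _ ih =>
      exact (hf a b a.2 b.2 hadj).trans ih
  have : Nat.card R ≤ Nat.card (removeVerts G S).ConnectedComponent := by
    refine Nat.card_le_card_of_injective
      (fun x : R => (removeVerts G S).connectedComponentMk ⟨x, by simpa using hR x x.2⟩) ?_
    intro x y hxy
    exact Subtype.ext (hinj x.2 y.2 (hreach _ _ (SimpleGraph.ConnectedComponent.eq.1 hxy)))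
  simpa [omega, numComponents] using this

/-- If every vertex of `G - S` is within distance two of a vertex of `R`, then `G - S` has at most
`|R|` components. -/
theorem omega_le_card {G : SimpleGraph V} {S R : Finset V}
    (h : ∀ x, x ∉ S → ∃ r ∈ R, r ∉ S ∧
      (x = r ∨ G.Adj r x ∨ ∃ y, y ∉ S ∧ G.Adj r y ∧ G.Adj y x)) : omega G S ≤ R.card := by
  have hsurj : ∀ c : (removeVerts G S).ConnectedComponent, ∃ r : R, ∃ hr : (r : V) ∉ S,
      (removeVerts G S).connectedComponentMk ⟨r, by simpa using hr⟩ = c := by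
    intro c
    obtain ⟨⟨x, hx⟩, rfl⟩ := c.exists_rep
    have hx' : x ∉ S := by simpa using hx
    obtain ⟨r, hr, hrS, hrx⟩ := h x hx'
    refine ⟨⟨r, hr⟩, hrS, SimpleGraph.ConnectedComponent.eq.2 ?_⟩
    rcases hrx with rfl | hadj | ⟨y, hy, h₁, h₂⟩
    · rfl
    · exact removeVerts_reachable hrS hx hadj
    · exact (removeVerts_reachable hrS hy h₁).trans (removeVerts_reachable hy hx h₂)
  choose g hg hg' using hsurj
  have : Nat.card (removeVerts G S).ConnectedComponent ≤ Nat.card R := by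
    refine Nat.card_le_card_of_injective g ?_
    intro c d hcd
    rw [← hg' c, ← hg' d]
    congr 2
    rw [hcd]
  simpa [omega, numComponents] using this

/-- If vertices connected in `G - S` are connected in `H - S`, then `H - S` has no more components
than `G - S`. -/
theorem omega_le_omega {G H : SimpleGraph V} {S : Finset V}
    (h : ∀ x y, (removeVerts G S).Reachable x y → (removeVerts H S).Reachable x y) :
    omega H S ≤ omega G S := by
  refine Nat.card_le_card_of_injective
    (fun c => (removeVerts G S).connectedComponentMk (Quot.out c)) ?_
  intro c d hcd
  have := SimpleGraph.ConnectedComponent.eq.2 (h _ _ (SimpleGraph.ConnectedComponent.eq.1 hcd))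
  rwa [show (removeVerts H S).connectedComponentMk (Quot.out c) = c from Quot.out_eq c,
    show (removeVerts H S).connectedComponentMk (Quot.out d) = d from Quot.out_eq d] at this

/-- Deleting `S` isolates the vertices of `J`; together with a further vertex, they lie in different
components. -/
theorem card_add_one_le_omega {G : SimpleGraph V} {S J : Finset V} {z : V}
    (hJ : ∀ w ∈ J, w ∉ S ∧ ∀ y, G.Adj w y → y ∈ S) (hzS : z ∉ S) (hzJ : z ∉ J) :
    J.card + 1 ≤ omega G S := by
  classical
  rw [← Finset.card_insert_of_notMem hzJ]
  refine card_le_omega (fun x => if x ∈ J then some x else none) ?_ ?_ ?_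
  · intro x y hx hy hxy
    rw [if_neg fun h => hy ((hJ x h).2 y hxy), if_neg fun h => hx ((hJ y h).2 x hxy.symm)]
  · intro x hx
    rcases Finset.mem_insert.1 hx with rfl | hx
    · exact hzS
    · exact (hJ x hx).1
  · intro x hx y hy hxy
    simp only [Finset.coe_insert, Set.mem_insert_iff, Finset.mem_coe] at hx hy
    rcases hx with rfl | hx <;> rcases hy with rfl | hy <;> simp_all

theorem card_le_omega_of_isolated {G : SimpleGraph V} {S J : Finset V}
    (hJ : ∀ w ∈ J, w ∉ S ∧ ∀ y, G.Adj w y → y ∈ S) : J.card ≤ omega G S := by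
  classical
  refine card_le_omega (fun x => if x ∈ J then some x else none) ?_ (fun x hx => (hJ x hx).1) ?_
  · intro x y hx hy hxy
    rw [if_neg fun h => hy ((hJ x h).2 y hxy), if_neg fun h => hx ((hJ y h).2 x hxy.symm)]
  · intro x hx y hy hxy
    simp_all

/-! ### Toughness -/

theorem le_toughness {V : Type*} {G : SimpleGraph V} {t : ℝ} (ht : 0 < t) (h : IsTough G t) :
    ENNReal.ofReal t ≤ toughness G := le_sSup ⟨t, ht, h, rfl⟩

theorem toughness_le {G : SimpleGraph V} {S : Finset V} (hS : 2 ≤ omega G S) :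
    toughness G ≤ ENNReal.ofReal (S.card / omega G S) := by
  refine sSup_le ?_
  rintro _ ⟨s, hs, hG, rfl⟩
  refine ENNReal.ofReal_le_ofReal ?_
  have : (0 : ℝ) < omega G S := by exact_mod_cast (by omega : 0 < omega G S)
  rw [le_div_iff₀ this]
  exact (isTough_iff hs).1 hG S hS

theorem toughness_lt_iff {G : SimpleGraph V} {t : ℝ} (ht : 0 < t) :
    toughness G < ENNReal.ofReal t ↔ ¬ IsTough G t := by
  refine ⟨fun h h' => absurd (le_toughness ht h') (not_le.2 h), fun h => ?_⟩
  rw [isTough_iff ht] at h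
  push Not at h
  obtain ⟨S, hS, hlt⟩ := h
  refine (toughness_le hS).trans_lt ((ENNReal.ofReal_lt_ofReal_iff ht).2 ?_)
  have : (0 : ℝ) < omega G S := by exact_mod_cast (by omega : 0 < omega G S)
  rwa [div_lt_iff₀ this]

theorem toughness_eq_iff {G : SimpleGraph V} {t : ℝ} (ht : 0 < t) :
    toughness G = ENNReal.ofReal t ↔
      IsTough G t ∧ ∃ S : Finset V, 2 ≤ omega G S ∧ (S.card : ℝ) ≤ t * omega G S := by
  constructor
  · intro h
    refine ⟨not_not.1 fun h' => ((toughness_lt_iff ht).2 h').ne h, ?_⟩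
    by_contra! hS
    -- there are finitely many cutsets, so that `G` is even `s`-tough for some `s > t`
    have hev : ∀ᶠ s : ℝ in nhdsWithin t (Set.Ioi t), ∀ S : Finset V, 2 ≤ omega G S →
        s * omega G S ≤ S.card := by
      rw [Filter.eventually_all]
      intro S
      by_cases h2 : 2 ≤ omega G S
      · have hc : Filter.Tendsto (fun s : ℝ => s * omega G S) (nhdsWithin t (Set.Ioi t))
            (nhds (t * omega G S)) :=
          ((continuous_id.mul continuous_const).tendsto t).mono_left nhdsWithin_le_nhds
        filter_upwards [hc.eventually (gt_mem_nhds (hS S h2))] with s hs _ using hs.le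
      · exact Filter.Eventually.of_forall fun s h => absurd h h2
    obtain ⟨s, hs, hts⟩ := (hev.and self_mem_nhdsWithin).exists
    have hts : t < s := hts
    have hs' := le_toughness (ht.trans hts) ((isTough_iff (ht.trans hts)).2 hs)
    rw [h, ENNReal.ofReal_le_ofReal_iff ht.le] at hs'
    exact absurd hts (not_lt.2 hs')
  · rintro ⟨hG, S, hS, hle⟩
    refine le_antisymm ((toughness_le hS).trans (ENNReal.ofReal_le_ofReal ?_)) (le_toughness ht hG)
    have : (0 : ℝ) < omega G S := by exact_mod_cast (by omega : 0 < omega G S)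
    rwa [div_le_iff₀ this]

/-- Deleting an edge `uv` of a `t`-tough graph can only destroy toughness through a set `S` that
separates `u` from `v` in `G - uv`. -/
theorem exists_separator {G : SimpleGraph V} {t : ℝ} (ht : 0 < t) (hG : IsTough G t) {u v : V}
    (h : ¬ IsTough (G.deleteEdges {s(u, v)}) t) :
    ∃ S : Finset V, u ∉ S ∧ v ∉ S ∧ (∀ x, G.Adj u x → G.Adj v x → x ∈ S) ∧
      (S.card : ℝ) < t * omega (G.deleteEdges {s(u, v)}) S := by
  rw [isTough_iff ht] at h hG
  push Not at h
  obtain ⟨S, hS, hlt⟩ := h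
  have hnot : ¬ ∀ x y, (removeVerts G S).Reachable x y →
      (removeVerts (G.deleteEdges {s(u, v)}) S).Reachable x y := by
    intro hr
    have hle := omega_le_omega hr
    have hle' : (omega (G.deleteEdges {s(u, v)}) S : ℝ) ≤ omega G S := by exact_mod_cast hle
    have := hG S (hS.trans hle)
    nlinarith
  -- hence the ends of the edge are not joined by a path avoiding the edge and `S`
  have hadj : ∃ x y, (removeVerts G S).Adj x y ∧
      ¬ (removeVerts (G.deleteEdges {s(u, v)}) S).Reachable x y := by
    by_contra! hc
    exact hnot fun x y => reachable_of_adj hc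
  obtain ⟨⟨x, hx⟩, ⟨y, hy⟩, hxy, hnr⟩ := hadj
  have hxy' : G.Adj x y := hxy
  have hx' : x ∉ S := by simpa using hx
  have hy' : y ∉ S := by simpa using hy
  have he : s(x, y) = s(u, v) := by
    by_contra hne
    refine hnr (SimpleGraph.Adj.reachable ?_)
    change (G.deleteEdges {s(u, v)}).Adj x y
    rw [SimpleGraph.deleteEdges_adj]
    exact ⟨hxy', by simpa using hne⟩
  have hcommon : ∀ z, G.Adj x z → G.Adj y z → z ∈ S := by
    intro z h₁ h₂
    by_contra hz
    have e₁ : (G.deleteEdges {s(u, v)}).Adj x z := by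
      rw [SimpleGraph.deleteEdges_adj, ← he]
      refine ⟨h₁, ?_⟩
      have := h₁.ne
      have := h₂.ne
      simp; tauto
    have e₂ : (G.deleteEdges {s(u, v)}).Adj z y := by
      rw [SimpleGraph.deleteEdges_adj, ← he]
      refine ⟨h₂.symm, ?_⟩
      have := h₁.ne
      have := h₂.ne
      simp; tauto
    exact hnr ((removeVerts_reachable hx hz e₁).trans (removeVerts_reachable hz hy e₂))
  rcases Sym2.eq_iff.1 he with ⟨rfl, rfl⟩ | ⟨rfl, rfl⟩
  · exact ⟨S, hx', hy', hcommon, hlt⟩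
  · exact ⟨S, hy', hx', fun z h₁ h₂ => hcommon z h₂ h₁, hlt⟩

/-- Minimal toughness in terms of component counts: `G` is `t`-tough, some cutset attains the bound,
and no graph obtained by deleting an edge is `t`-tough. -/
theorem isMinimallyTough_iff {G : SimpleGraph V} {t : ℝ} (ht : 0 < t) :
    IsMinimallyTough G t ↔ IsTough G t ∧
      (∃ S : Finset V, 2 ≤ omega G S ∧ (S.card : ℝ) ≤ t * omega G S) ∧
      ∀ u v, G.Adj u v → ¬ IsTough (G.deleteEdges {s(u, v)}) t := by
  rw [IsMinimallyTough, toughness_eq_iff ht, and_assoc]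
  refine and_congr_right fun _ => and_congr_right fun _ => ⟨fun h u v huv => ?_, fun h e he => ?_⟩
  · exact (toughness_lt_iff ht).1 (h s(u, v) huv)
  · induction e with
    | _ u v => exact (toughness_lt_iff ht).2 (h u v he)

/-! ### Tough split graphs -/

open Classical in
/-- The neighbours of `x` outside `C`. -/
noncomputable def leaves (G : SimpleGraph V) (C : Finset V) (x : V) : Finset V :=
  Finset.univ.filter fun w => w ∉ C ∧ G.Adj x w

theorem mem_leaves {G : SimpleGraph V} {C : Finset V} {x w : V} :
    w ∈ leaves G C x ↔ w ∉ C ∧ G.Adj x w := by simp [leaves]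

open Classical in
/-- The vertices outside `C` that are adjacent neither to `u` nor to `v`. -/
noncomputable def strangers (G : SimpleGraph V) (C : Finset V) (u v : V) : Finset V :=
  Finset.univ.filter fun w => w ∉ C ∧ ¬ G.Adj u w ∧ ¬ G.Adj v w

theorem mem_strangers {G : SimpleGraph V} {C : Finset V} {u v w : V} :
    w ∈ strangers G C u v ↔ w ∉ C ∧ ¬ G.Adj u w ∧ ¬ G.Adj v w := by simp [strangers]

/-- The toughness inequality for a set `S` that isolates the vertices of `J` and leaves a further
vertex. -/
theorem IsTough.mul_card_add_one_le {G : SimpleGraph V} {t : ℝ} (ht : 0 < t) (hG : IsTough G t)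
    {S J : Finset V} {z : V} (hJ : ∀ w ∈ J, w ∉ S ∧ ∀ y, G.Adj w y → y ∈ S) (hzS : z ∉ S)
    (hzJ : z ∉ J) (hne : J.Nonempty) : t * (J.card + 1) ≤ S.card := by
  have h := card_add_one_le_omega hJ hzS hzJ
  have h1 : 1 ≤ J.card := hne.card_pos
  have h' : ((J.card + 1 : ℕ) : ℝ) ≤ omega G S := by exact_mod_cast h
  have := (isTough_iff ht).1 hG S (by omega)
  push_cast at h'
  nlinarith

theorem IsTough.mul_card_le {G : SimpleGraph V} {t : ℝ} (ht : 0 < t) (hG : IsTough G t)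
    {S J : Finset V} (hJ : ∀ w ∈ J, w ∉ S ∧ ∀ y, G.Adj w y → y ∈ S) (h2 : 2 ≤ J.card) :
    t * J.card ≤ S.card := by
  have h := card_le_omega_of_isolated hJ
  have h' : (J.card : ℝ) ≤ omega G S := by exact_mod_cast h
  have := (isTough_iff ht).1 hG S (by omega)
  nlinarith

open Classical in
/-- What it means for an edge `uv` of the clique of a tough split graph to be critical: the
separating set contains the rest of the clique and the common neighbours of `u` and `v`, and leaves
at most the components of `u` and `v` and isolated vertices. -/
theorem IsTough.lt_of_critical {G : SimpleGraph V} {t : ℝ} (ht : 0 < t) (hG : IsTough G t)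
    {C : Finset V} (hC : G.IsClique C) {u v : V}
    (hu : u ∈ C) (hv : v ∈ C) (huv : u ≠ v) (h : ¬ IsTough (G.deleteEdges {s(u, v)}) t) :
    (C.card : ℝ) - 2 + (leaves G C u ∩ leaves G C v).card <
      t * (2 + (strangers G C u v).card) := by
  obtain ⟨S, huS, hvS, hcommon, hlt⟩ := exists_separator ht hG h
  have h₁ : (C \ {u, v}) ∪ (leaves G C u ∩ leaves G C v) ⊆ S := by
    intro x hx
    simp only [Finset.mem_union, Finset.mem_sdiff, Finset.mem_insert, Finset.mem_singleton,
      Finset.mem_inter, mem_leaves] at hx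
    rcases hx with ⟨hxC, hx⟩ | hx
    · push Not at hx
      exact hcommon x (hC hu hxC hx.1.symm) (hC hv hxC hx.2.symm)
    · exact hcommon x hx.1.2 hx.2.2
  have h₂ : C.card - 2 + (leaves G C u ∩ leaves G C v).card ≤ S.card := by
    refine le_trans (le_of_eq ?_) (Finset.card_le_card h₁)
    rw [Finset.card_union_of_disjoint, Finset.card_sdiff_of_subset, Finset.card_pair huv]
    · intro x hx
      simp only [Finset.mem_insert, Finset.mem_singleton] at hx
      rcases hx with rfl | rfl <;> assumption
    · rw [Finset.disjoint_left]
      intro x hx hx'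
      exact (mem_leaves.1 (Finset.mem_inter.1 hx').1).1 (Finset.mem_sdiff.1 hx).1
  have hC2 : 2 ≤ C.card := by
    rw [← Finset.card_pair huv]
    refine Finset.card_le_card fun x hx => ?_
    simp only [Finset.mem_insert, Finset.mem_singleton] at hx
    rcases hx with rfl | rfl <;> assumption
  have h₃ : omega (G.deleteEdges {s(u, v)}) S ≤ ({u, v} ∪ strangers G C u v : Finset V).card := by
    -- only strangers of `u` and `v` can lie outside the components of `u` and `v`
    have : ∀ x, x ∉ S → x = u ∨ x = v ∨ x ∉ C ∧ x ≠ u ∧ x ≠ v := by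
      intro x hx
      by_cases hxu : x = u
      · exact Or.inl hxu
      by_cases hxv : x = v
      · exact Or.inr (Or.inl hxv)
      refine Or.inr (Or.inr ⟨fun hxC => hx ?_, hxu, hxv⟩)
      exact hcommon x (hC hu hxC (Ne.symm hxu)) (hC hv hxC (Ne.symm hxv))
    have : omega (G.deleteEdges {s(u, v)}) S ≤
        ({u, v} ∪ (strangers G C u v).filter (· ∉ S) : Finset V).card := by
      refine omega_le_card fun x hx => ?_
      rcases this x hx with rfl | rfl | ⟨hxC, hxu, hxv⟩
      · exact ⟨x, by simp, hx, Or.inl rfl⟩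
      · exact ⟨x, by simp, hx, Or.inl rfl⟩
      · by_cases hux : G.Adj u x
        · refine ⟨u, by simp, huS, Or.inr (Or.inl ?_)⟩
          rw [SimpleGraph.deleteEdges_adj]
          exact ⟨hux, by simp; tauto⟩
        · by_cases hvx : G.Adj v x
          · refine ⟨v, by simp, hvS, Or.inr (Or.inl ?_)⟩
            rw [SimpleGraph.deleteEdges_adj]
            exact ⟨hvx, by simp; tauto⟩
          · exact ⟨x, by simp [mem_strangers, hxC, hux, hvx, hx], hx, Or.inl rfl⟩
    exact this.trans (Finset.card_le_card
      (Finset.union_subset_union_right (Finset.filter_subset _ _)))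
  have h₄ : omega (G.deleteEdges {s(u, v)}) S ≤ 2 + (strangers G C u v).card := by
    refine h₃.trans ((Finset.card_union_le _ _).trans ?_)
    rw [Finset.card_pair huv]
  have h₂' : (C.card : ℝ) + (leaves G C u ∩ leaves G C v).card ≤ S.card + 2 := by
    exact_mod_cast (by omega :
      C.card + (leaves G C u ∩ leaves G C v).card ≤ S.card + 2)
  have h₄' : (omega (G.deleteEdges {s(u, v)}) S : ℝ) ≤ 2 + (strangers G C u v).card := by
    exact_mod_cast h₄
  nlinarith

/-- In a split graph with clique `C` that is tough and all of whose clique edges are critical,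
vertices of the clique with a common neighbour outside have all their outer neighbours in common. -/
theorem twins_of_common {G : SimpleGraph V} {t : ℝ} (ht : 0 < t) (hG : IsTough G t)
    (hcrit : ∀ u v, G.Adj u v → ¬ IsTough (G.deleteEdges {s(u, v)}) t) {C : Finset V}
    (hC : G.IsClique C) (hI : ∀ x ∉ C, ∀ y ∉ C, ¬ G.Adj x y) {u v w : V} (hu : u ∈ C) (hv : v ∈ C)
    (hw : w ∉ C) (huw : G.Adj u w) (hvw : G.Adj v w) {w' : V} (hw' : w' ∉ C)
    (hvw' : G.Adj v w') : G.Adj u w' := by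
  classical
  by_contra huw'
  -- removing `C` except `u` isolates `w'` and all vertices adjacent neither to `u` nor to `v`
  have huv : u ≠ v := by rintro rfl; exact huw' hvw'
  have hstar := hG.lt_of_critical ht hC hu hv huv (hcrit u v (hC hu hv huv))
  have h₁ := hG.mul_card_add_one_le ht (S := C.erase u) (J := insert w' (strangers G C u v))
    (z := u) (by
      intro x hx
      have hx' : x ∉ C ∧ ¬ G.Adj u x := by
        rcases Finset.mem_insert.1 hx with rfl | hx
        · exact ⟨hw', huw'⟩
        · exact ⟨(mem_strangers.1 hx).1, (mem_strangers.1 hx).2.1⟩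
      refine ⟨fun h => hx'.1 (Finset.mem_of_mem_erase h), fun y hxy => ?_⟩
      refine Finset.mem_erase.2 ⟨?_, ?_⟩
      · rintro rfl
        exact hx'.2 hxy.symm
      · by_contra hy
        exact hI x hx'.1 y hy hxy) (by simp) (by
      simp only [Finset.mem_insert, mem_strangers, not_or]
      exact ⟨fun h => hw' (h ▸ hu), fun h => h.1 hu⟩) (Finset.insert_nonempty _ _)
  have hcard : (insert w' (strangers G C u v)).card = (strangers G C u v).card + 1 :=
    Finset.card_insert_of_notMem fun h => (mem_strangers.1 h).2.2 hvw'
  have hB : 1 ≤ (leaves G C u ∩ leaves G C v).card :=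
    Finset.card_pos.2 ⟨w, Finset.mem_inter.2 ⟨mem_leaves.2 ⟨hw, huw⟩, mem_leaves.2 ⟨hw, hvw⟩⟩⟩
  have hCc : ((C.erase u).card : ℝ) + 1 = C.card := by
    exact_mod_cast Finset.card_erase_add_one hu
  have hB' : (1 : ℝ) ≤ (leaves G C u ∩ leaves G C v).card := by exact_mod_cast hB
  rw [hcard] at h₁
  push_cast at h₁
  nlinarith

/-- A clique `C` all of whose outer vertices are pendant: they have exactly one neighbour, and it
lies in `C`. -/
structure IsPendantClique (G : SimpleGraph V) (C : Finset V) : Prop where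
  clique : G.IsClique C
  pendant : ∀ u ∉ C, ∃ p ∈ C, ∀ v, G.Adj u v ↔ v = p

/-- In a noncomplete split graph that is tough and all of whose clique edges are critical, no two
vertices of the clique have a common neighbour outside, provided that every vertex of the clique has
some neighbour outside. -/
theorem eq_of_common {G : SimpleGraph V} {t : ℝ} (ht : 0 < t) (hG : IsTough G t)
    (hcrit : ∀ u v, G.Adj u v → ¬ IsTough (G.deleteEdges {s(u, v)}) t)
    (hnc : ∃ x y, x ≠ y ∧ ¬ G.Adj x y) {C : Finset V}
    (hC : G.IsClique C) (hI : ∀ x ∉ C, ∀ y ∉ C, ¬ G.Adj x y)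
    (hleaf : ∀ x ∈ C, ∃ w ∉ C, G.Adj x w) {u v w : V} (hu : u ∈ C) (hv : v ∈ C)
    (hw : w ∉ C) (huw : G.Adj u w) (hvw : G.Adj v w) : u = v := by
  classical
  by_contra huv
  have hstar := hG.lt_of_critical ht hC hu hv huv (hcrit u v (hC hu hv huv))
  have hinC : ∀ x ∉ C, ∀ y, G.Adj x y → y ∈ C := fun x hx y hxy => by
    by_contra hy
    exact hI x hx y hy hxy
  have htw : leaves G C u ∩ leaves G C v = leaves G C u := by
    refine Finset.inter_eq_left.2 fun x hx => ?_
    rw [mem_leaves] at hx ⊢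
    exact ⟨hx.1, twins_of_common ht hG hcrit hC hI hv hu hw hvw huw hx.1 hx.2⟩
  have hB : 1 ≤ (leaves G C u).card := Finset.card_pos.2 ⟨w, mem_leaves.2 ⟨hw, huw⟩⟩
  have hB' : (1 : ℝ) ≤ (leaves G C u).card := by exact_mod_cast hB
  rw [htw] at hstar
  -- the vertices of `C` with the same outer neighbours as `u`
  set P := C.filter fun x => G.Adj x w with hP
  have hPc : 2 ≤ P.card := by
    rw [← Finset.card_pair huv]
    refine Finset.card_le_card fun x hx => ?_
    simp only [Finset.mem_insert, Finset.mem_singleton] at hx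
    rcases hx with rfl | rfl <;> simp [*]
  have hPc' : (2 : ℝ) ≤ P.card := by exact_mod_cast hPc
  have hPC : P.card + (C \ P).card = C.card := by
    rw [add_comm]
    exact Finset.card_sdiff_add_card_eq_card (Finset.filter_subset _ _)
  have hPC' : (P.card : ℝ) + (C \ P).card = C.card := by exact_mod_cast hPC
  rcases (strangers G C u v).eq_empty_or_nonempty with hA | hA
  · -- all outer vertices are adjacent to all of `C`
    have hall : ∀ x ∉ C, G.Adj u x := by
      intro x hx
      by_contra hux
      have : x ∈ strangers G C u v := mem_strangers.2 ⟨hx, hux, fun hvx =>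
        hux (twins_of_common ht hG hcrit hC hI hu hv hw huw hvw hx hvx)⟩
      simp [hA] at this
    have hjoin : ∀ x ∉ C, ∀ y ∈ C, G.Adj y x := by
      intro x hx y hy
      obtain ⟨x', hx', hyx'⟩ := hleaf y hy
      exact twins_of_common ht hG hcrit hC hI hy hu hx' hyx' (hall x' hx') hx (hall x hx)
    have hleaves : ∀ x, x ∈ leaves G C u ↔ x ∉ C := fun x => by
      rw [mem_leaves]
      exact ⟨fun h => h.1, fun h => ⟨h, hall x h⟩⟩
    by_cases hi : 2 ≤ (leaves G C u).card
    · have h₁ := hG.mul_card_le ht (S := C) (J := leaves G C u)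
        (fun x hx => ⟨(hleaves x).1 hx, hinC x ((hleaves x).1 hx)⟩) hi
      have hi' : (2 : ℝ) ≤ (leaves G C u).card := by exact_mod_cast hi
      rw [hA] at hstar
      simp only [Finset.card_empty, Nat.cast_zero, add_zero] at hstar
      have hc : (2 : ℝ) ≤ C.card := by linarith [(Nat.cast_nonneg (C \ P).card : (0 : ℝ) ≤ _)]
      have h₂ : ((leaves G C u).card : ℝ) * ((C.card : ℝ) - 2 + (leaves G C u).card) <
          2 * C.card := by nlinarith
      nlinarith [mul_nonneg (sub_nonneg.2 hi')
        (by linarith : (0 : ℝ) ≤ C.card + (leaves G C u).card)]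
    · obtain ⟨x, y, hxy, hnadj⟩ := hnc
      apply hnadj
      by_cases hx : x ∈ C <;> by_cases hy : y ∈ C
      · exact hC hx hy hxy
      · exact hjoin y hy x hx
      · exact (hjoin x hx y hy).symm
      · exact absurd (Finset.card_le_one.1 (by omega) x ((hleaves x).2 hx) y ((hleaves y).2 hy)) hxy
  · -- toughness for `C \ P` and for `P` bounds `|C|` from below, against the criticality of `uv`
    obtain ⟨a, ha⟩ := hA
    have ha' := mem_strangers.1 ha
    have h₁ := hG.mul_card_add_one_le ht (S := C \ P) (J := strangers G C u v) (z := u) (by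
      intro x hx
      have hx' := mem_strangers.1 hx
      refine ⟨fun h => hx'.1 (Finset.mem_sdiff.1 h).1, fun y hxy => ?_⟩
      have hy := hinC x hx'.1 y hxy
      refine Finset.mem_sdiff.2 ⟨hy, fun hyP => hx'.2.1 ?_⟩
      exact twins_of_common ht hG hcrit hC hI hu hy hw huw (Finset.mem_filter.1 hyP).2 hx'.1
        hxy.symm) (by simp [hP, hu, huw]) (fun h => (mem_strangers.1 h).1 hu) ⟨a, ha⟩
    have h₂ := hG.mul_card_add_one_le ht (S := P) (J := leaves G C u) (z := a) (by
      intro x hx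
      have hx' := mem_leaves.1 hx
      refine ⟨fun h => hx'.1 (Finset.mem_filter.1 h).1, fun y hxy => ?_⟩
      have hy := hinC x hx'.1 y hxy
      refine Finset.mem_filter.2 ⟨hy, ?_⟩
      exact twins_of_common ht hG hcrit hC hI hy hu hx'.1 hxy.symm hx'.2 hw huw)
      (fun h => ha'.1 (Finset.mem_filter.1 h).1) (fun h => ha'.2.1 (mem_leaves.1 h).2)
      ⟨w, mem_leaves.2 ⟨hw, huw⟩⟩
    nlinarith

/-! ### Cliques with pendant vertices -/

theorem IsPendantClique.not_adj {V : Type*} {G : SimpleGraph V} {C : Finset V}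
    (h : IsPendantClique G C) :
    ∀ x ∉ C, ∀ y ∉ C, ¬ G.Adj x y := by
  intro x hx y hy hxy
  obtain ⟨p, hp, hp'⟩ := h.pendant x hx
  exact hy ((hp' y).1 hxy ▸ hp)

theorem IsPendantClique.eq_of_adj {V : Type*} {G : SimpleGraph V} {C : Finset V}
    (h : IsPendantClique G C)
    {x y w : V} (hw : w ∉ C) (hx : G.Adj x w) (hy : G.Adj y w) : x = y := by
  obtain ⟨p, _, hp⟩ := h.pendant w hw
  rw [(hp x).1 hx.symm, (hp y).1 hy.symm]

open Classical in
/-- A cutset of a clique with pendant vertices isolates at most the leaves of its vertices. -/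
theorem IsPendantClique.omega_le {G : SimpleGraph V} {C : Finset V} (h : IsPendantClique G C)
    {S : Finset V} (hS : 2 ≤ omega G S) :
    omega G S ≤ ∑ x ∈ C.filter (· ∈ S), ((leaves G C x).card + 1) := by
  set P := C.filter (· ∈ S) with hP
  set R := P.biUnion (leaves G C) with hR
  have hRc : R.card ≤ ∑ x ∈ P, (leaves G C x).card := Finset.card_biUnion_le
  have hsum : ∑ x ∈ P, ((leaves G C x).card + 1) = ∑ x ∈ P, (leaves G C x).card + P.card := by
    simp [Finset.sum_add_distrib]
  have hout : ∀ x ∉ C, (x ∈ R) ∨ ∃ p ∈ C, p ∉ S ∧ G.Adj p x := by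
    intro x hx
    obtain ⟨p, hp, hp'⟩ := h.pendant x hx
    have hpx : G.Adj p x := ((hp' p).2 rfl).symm
    by_cases hpS : p ∈ S
    · exact Or.inl (Finset.mem_biUnion.2 ⟨p, Finset.mem_filter.2 ⟨hp, hpS⟩, mem_leaves.2 ⟨hx, hpx⟩⟩)
    · exact Or.inr ⟨p, hp, hpS, hpx⟩
  by_cases hCS : C ⊆ S
  · have : omega G S ≤ R.card := by
      refine omega_le_card fun x hx => ?_
      rcases hout x (fun h => hx (hCS h)) with hxR | ⟨p, hp, hpS, _⟩
      · exact ⟨x, hxR, hx, Or.inl rfl⟩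
      · exact absurd (hCS hp) hpS
    omega
  · obtain ⟨c, hc, hcS⟩ := Finset.not_subset.1 hCS
    have : omega G S ≤ (insert c R).card := by
      refine omega_le_card fun x hx => ?_
      by_cases hxC : x ∈ C
      · by_cases hxc : x = c
        · exact ⟨x, by simp [hxc], hx, Or.inl rfl⟩
        · exact ⟨c, by simp, hcS, Or.inr (Or.inl (h.clique hc hxC (Ne.symm hxc)))⟩
      · rcases hout x hxC with hxR | ⟨p, hp, hpS, hpx⟩
        · exact ⟨x, Finset.mem_insert_of_mem hxR, hx, Or.inl rfl⟩
        · refine ⟨c, by simp, hcS, ?_⟩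
          by_cases hpc : p = c
          · exact Or.inr (Or.inl (hpc ▸ hpx))
          · exact Or.inr (Or.inr ⟨p, hpS, h.clique hc hp (Ne.symm hpc), hpx⟩)
    have h1 := Finset.card_insert_le c R
    have hPpos : 1 ≤ P.card := by
      by_contra h0
      have : P = ∅ := Finset.card_eq_zero.1 (by omega)
      simp only [this, Finset.sum_empty] at hRc
      omega
    omega

theorem IsPendantClique.isTough {G : SimpleGraph V} {t : ℝ} (ht : 0 < t) {C : Finset V}
    (h : IsPendantClique G C) (hl : ∀ x ∈ C, t * ((leaves G C x).card + 1) ≤ 1) : IsTough G t := by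
  classical
  rw [isTough_iff ht]
  intro S hS
  have h₁ : (omega G S : ℝ) ≤ ∑ x ∈ C.filter (· ∈ S), (((leaves G C x).card : ℝ) + 1) := by
    exact_mod_cast h.omega_le hS
  have h₂ : t * ∑ x ∈ C.filter (· ∈ S), (((leaves G C x).card : ℝ) + 1) ≤
      (C.filter (· ∈ S)).card := by
    rw [Finset.mul_sum]
    simpa using Finset.sum_le_card_nsmul (C.filter (· ∈ S)) _ (1 : ℝ)
      (fun x hx => hl x (Finset.mem_filter.1 hx).1)
  have h₃ : ((C.filter (· ∈ S)).card : ℝ) ≤ S.card := by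
    exact_mod_cast Finset.card_le_card fun x hx => (Finset.mem_filter.1 hx).2
  nlinarith

/-- If a clique with pendant vertices is exactly `t`-tough, then the toughness is attained at the
removal of a single vertex. -/
theorem IsPendantClique.exists_eq {G : SimpleGraph V} {t : ℝ} (ht : 0 < t) {C : Finset V}
    (h : IsPendantClique G C) (hl : ∀ x ∈ C, t * ((leaves G C x).card + 1) ≤ 1)
    (htight : ∃ S : Finset V, 2 ≤ omega G S ∧ (S.card : ℝ) ≤ t * omega G S) :
    ∃ x ∈ C, t * ((leaves G C x).card + 1) = 1 := by
  classical
  by_contra! hne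
  obtain ⟨S, hS, hle⟩ := htight
  have h₁ : (omega G S : ℝ) ≤ ∑ x ∈ C.filter (· ∈ S), (((leaves G C x).card : ℝ) + 1) := by
    exact_mod_cast h.omega_le hS
  have h₂ : t * ∑ x ∈ C.filter (· ∈ S), (((leaves G C x).card : ℝ) + 1) <
      (C.filter (· ∈ S)).card := by
    rw [Finset.mul_sum, Finset.card_eq_sum_ones, Nat.cast_sum]
    refine Finset.sum_lt_sum_of_nonempty ?_ fun x hx => ?_
    · by_contra h0
      have := h.omega_le hS
      rw [Finset.not_nonempty_iff_eq_empty.1 h0] at this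
      simp at this
      omega
    · have hx := (Finset.mem_filter.1 hx).1
      simpa using lt_of_le_of_ne (hl x hx) (hne x hx)
  have h₃ : ((C.filter (· ∈ S)).card : ℝ) ≤ S.card := by
    exact_mod_cast Finset.card_le_card fun x hx => (Finset.mem_filter.1 hx).2
  nlinarith

/-- The minimally `1 / m`-tough split graphs: two adjacent vertices with pendant vertices, at most
`m - 1` at each and exactly `m - 1` at one of them, and triangles with `m - 1` pendant vertices at
each vertex. (Stars are the case of no pendant vertices at one of the two vertices.) -/
def IsExtremal (G : SimpleGraph V) (m : ℕ) (C : Finset V) : Prop :=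
  IsPendantClique G C ∧ (∀ x ∈ C, (leaves G C x).card + 1 ≤ m) ∧
    (∃ x ∈ C, (leaves G C x).card + 1 = m) ∧
    (C.card = 2 ∨ C.card = 3 ∧ ∀ x ∈ C, (leaves G C x).card + 1 = m)

/-- Deleting the edge at a pendant vertex disconnects the graph. -/
theorem not_isTough_of_leaf_edge {G : SimpleGraph V} {t : ℝ} (ht : 0 < t) {C : Finset V}
    (h : IsPendantClique G C) {u v : V} (hu : u ∉ C) (huv : G.Adj u v) :
    ¬ IsTough (G.deleteEdges {s(u, v)}) t := by
  intro hT
  have := hT.mul_card_add_one_le ht (S := ∅) (J := {u}) (z := v) (by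
    intro w hw
    obtain rfl := Finset.mem_singleton.1 hw
    refine ⟨by simp, fun y hy => ?_⟩
    rw [SimpleGraph.deleteEdges_adj] at hy
    obtain ⟨p, _, hp⟩ := h.pendant w hu
    obtain rfl := (hp y).1 hy.1
    obtain rfl := (hp v).1 huv
    simp at hy) (by simp) (by simpa using huv.ne') (by simp)
  simp at this
  linarith

/-- After deleting an edge `uv` of the clique, the other vertices of the clique separate `u`, `v` and
the pendant vertices adjacent to neither. -/
theorem not_isTough_of_clique_edge {G : SimpleGraph V} {t : ℝ} (ht : 0 < t) {C : Finset V}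
    (h : IsPendantClique G C) {u v : V} (hu : u ∈ C) (hv : v ∈ C) (huv : u ≠ v)
    (hlt : (C.card : ℝ) - 2 < t * (2 + (strangers G C u v).card)) :
    ¬ IsTough (G.deleteEdges {s(u, v)}) t := by
  classical
  have hsub : ({u, v} : Finset V) ⊆ C := by
    intro x hx
    simp only [Finset.mem_insert, Finset.mem_singleton] at hx
    rcases hx with rfl | rfl <;> assumption
  have hcard : (({u, v} ∪ strangers G C u v : Finset V)).card = 2 + (strangers G C u v).card := by
    rw [Finset.card_union_of_disjoint, Finset.card_pair huv]
    rw [Finset.disjoint_left]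
    intro x hx hx'
    exact (mem_strangers.1 hx').1 (hsub hx)
  have hS : ∀ x, x ∉ C \ {u, v} → x ∈ C → x = u ∨ x = v := by
    intro x hx hxC
    by_contra hne
    exact hx (Finset.mem_sdiff.2 ⟨hxC, by simpa using hne⟩)
  -- the components are told apart by sending a stranger to itself, and any other vertex to the one
  -- of `u` and `v` in whose component it lies
  have hω : (({u, v} ∪ strangers G C u v : Finset V)).card ≤
      omega (G.deleteEdges {s(u, v)}) (C \ {u, v}) := by
    refine card_le_omega (fun x => if x ∈ strangers G C u v then x else
      if x = v ∨ x ∉ C ∧ G.Adj v x then v else u) ?_ ?_ ?_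
    · have key : ∀ x y, x ∈ C → x ∉ C \ {u, v} → y ∉ C \ {u, v} →
          (G.deleteEdges {s(u, v)}).Adj x y →
          (if x ∈ strangers G C u v then x else if x = v ∨ x ∉ C ∧ G.Adj v x then v else u) =
          (if y ∈ strangers G C u v then y else if y = v ∨ y ∉ C ∧ G.Adj v y then v else u) := by
        intro x y hxC hx hy hxy
        rw [SimpleGraph.deleteEdges_adj] at hxy
        obtain ⟨hxy, hne⟩ := hxy
        have hyC : y ∉ C := by
          intro hyC
          have := hxy.ne
          rcases hS x hx hxC with rfl | rfl <;> rcases hS y hy hyC with rfl | rfl <;>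
            simp at hne this
        have hxs : x ∉ strangers G C u v := fun hs => (mem_strangers.1 hs).1 hxC
        have hyv : y ≠ v := fun e => hyC (e ▸ hv)
        rcases hS x hx hxC with rfl | rfl
        · have hys : y ∉ strangers G C x v := fun hs => (mem_strangers.1 hs).2.1 hxy
          have : ¬ G.Adj v y := fun hvy => huv (h.eq_of_adj hyC hxy hvy)
          simp [hxs, hys, huv, hxC, hyv, this]
        · have hys : y ∉ strangers G C u x := fun hs => (mem_strangers.1 hs).2.2 hxy
          simp [hxs, hys, hyC, hxy]
      intro x y hx hy hxy
      by_cases hxC : x ∈ C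
      · exact key x y hxC hx hy hxy
      · by_cases hyC : y ∈ C
        · exact (key y x hyC hy hx hxy.symm).symm
        · exact absurd (G.deleteEdges_le _ hxy) (h.not_adj x hxC y hyC)
    · intro x hx hx'
      rcases Finset.mem_union.1 hx with hx | hx
      · exact (Finset.mem_sdiff.1 hx').2 hx
      · exact (mem_strangers.1 hx).1 (Finset.mem_sdiff.1 hx').1
    · have hfix : ∀ x ∈ ({u, v} ∪ strangers G C u v : Finset V),
          (if x ∈ strangers G C u v then x else
            if x = v ∨ x ∉ C ∧ G.Adj v x then v else u) = x := by
        intro x hx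
        by_cases hxs : x ∈ strangers G C u v
        · simp [hxs]
        · rcases Finset.mem_union.1 hx with hx | hx
          · simp only [Finset.mem_insert, Finset.mem_singleton] at hx
            rcases hx with rfl | rfl
            · simp [hxs, huv, hu]
            · simp [hxs]
          · exact absurd hx hxs
      intro x hx y hy hxy
      have := hfix x (Finset.mem_coe.1 hx)
      have := hfix y (Finset.mem_coe.1 hy)
      simp only at hxy
      simp_all
  rw [hcard] at hω
  intro hT
  have h₁ := (isTough_iff ht).1 hT (C \ {u, v}) (by omega)
  have h₂ : ((C \ {u, v}).card : ℝ) + 2 = C.card := by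
    have := Finset.card_sdiff_add_card_eq_card hsub
    rw [Finset.card_pair huv] at this
    exact_mod_cast this
  have h₃ : (2 : ℝ) + (strangers G C u v).card ≤
      omega (G.deleteEdges {s(u, v)}) (C \ {u, v}) := by exact_mod_cast hω
  nlinarith

/-- The third vertex of a triangle with pendant vertices. -/
theorem exists_third {V : Type*} {C : Finset V} (h3 : C.card = 3) {u v : V} (hu : u ∈ C)
    (hv : v ∈ C) (huv : u ≠ v) : ∃ z ∈ C, z ≠ u ∧ z ≠ v ∧ ∀ x ∈ C, x ≠ u → x ≠ v → x = z := by
  classical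
  have : (C \ {u, v}).card = 1 := by
    have hsub : ({u, v} : Finset V) ⊆ C := by
      intro x hx
      simp only [Finset.mem_insert, Finset.mem_singleton] at hx
      rcases hx with rfl | rfl <;> assumption
    rw [Finset.card_sdiff_of_subset hsub, h3, Finset.card_pair huv]
  obtain ⟨z, hz⟩ := Finset.card_eq_one.1 this
  have hz' : z ∈ C \ {u, v} := by simp [hz]
  simp only [Finset.mem_sdiff, Finset.mem_insert, Finset.mem_singleton, not_or] at hz'
  refine ⟨z, hz'.1, hz'.2.1, hz'.2.2, fun x hx h₁ h₂ => ?_⟩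
  have : x ∈ C \ {u, v} := by simp [hx, h₁, h₂]
  simpa [hz] using this

theorem IsExtremal.isSplit {G : SimpleGraph V} {m : ℕ} {C : Finset V} (h : IsExtremal G m C) :
    IsSplit G :=
  ⟨C, h.1.clique, fun x hx y hy _ => h.1.not_adj x (by simpa using hx) y (by simpa using hy)⟩

theorem IsExtremal.isMinimallyTough {G : SimpleGraph V} {m : ℕ} {C : Finset V}
    (h : IsExtremal G m C) (hm : 2 ≤ m) : IsMinimallyTough G (1 / m) := by
  have hm0 : (0 : ℝ) < m := by exact_mod_cast (by omega : 0 < m)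
  have ht : (0 : ℝ) < 1 / m := by positivity
  obtain ⟨hC, hle, ⟨x, hx, hxm⟩, hcard⟩ := h
  rw [isMinimallyTough_iff ht]
  refine ⟨hC.isTough ht fun y hy => ?_, ⟨{x}, ?_⟩, ?_⟩
  · rw [div_mul_eq_mul_div, one_mul, div_le_one hm0]
    exact_mod_cast hle y hy
  · have hC2 : 1 < C.card := by omega
    obtain ⟨z, hz, hzx⟩ := Finset.exists_mem_ne hC2 x
    have hω : m ≤ omega G {x} := by
      rw [← hxm]
      refine card_add_one_le_omega (J := leaves G C x) (z := z) (fun w hw => ?_)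
        (by simpa using hzx) (fun h => (mem_leaves.1 h).1 hz)
      have hw := mem_leaves.1 hw
      refine ⟨fun h => hw.1 (Finset.mem_singleton.1 h ▸ hx), fun y hy => ?_⟩
      exact Finset.mem_singleton.2 (hC.eq_of_adj hw.1 hy.symm hw.2)
    refine ⟨by omega, ?_⟩
    rw [div_mul_eq_mul_div, one_mul, le_div_iff₀ hm0]
    simpa using hω
  · intro u v huv
    by_cases hu : u ∈ C
    · by_cases hv : v ∈ C
      · refine not_isTough_of_clique_edge ht hC hu hv huv.ne ?_
        rw [div_mul_eq_mul_div, one_mul, lt_div_iff₀ hm0]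
        rcases hcard with h2 | ⟨h3, hall⟩
        · rw [h2]
          norm_num
          positivity
        · obtain ⟨z, hz, hzu, hzv, _⟩ := exists_third h3 hu hv huv.ne
          have : (leaves G C z).card ≤ (strangers G C u v).card := by
            refine Finset.card_le_card fun w hw => ?_
            have hw := mem_leaves.1 hw
            exact mem_strangers.2 ⟨hw.1, fun h => hzu (hC.eq_of_adj hw.1 hw.2 h),
              fun h => hzv (hC.eq_of_adj hw.1 hw.2 h)⟩
          have h₁ := hall z hz
          have h₂ : (m : ℝ) + 1 ≤ 2 + (strangers G C u v).card := by
            exact_mod_cast (by omega : m + 1 ≤ 2 + (strangers G C u v).card)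
          rw [h3]
          push_cast
          linarith
      · rw [Sym2.eq_swap]
        exact not_isTough_of_leaf_edge ht hC hv huv.symm
    · exact not_isTough_of_leaf_edge ht hC hu huv

/-! ### The structure of minimally tough split graphs -/

/-- In a split graph, every vertex of the clique can be assumed to have a
neighbour outside: a vertex without such a neighbour can be moved to the independent set. -/
theorem IsSplit.exists_partition {G : SimpleGraph V} (h : IsSplit G) :
    ∃ C : Finset V, G.IsClique C ∧ (∀ x ∉ C, ∀ y ∉ C, ¬ G.Adj x y) ∧
      ∀ x ∈ C, ∃ w ∉ C, G.Adj x w := by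
  classical
  obtain ⟨C', hC', hI'⟩ := h
  obtain ⟨C, rfl⟩ : ∃ C : Finset V, (C : Set V) = C' := ⟨C'.toFinset, by simp⟩
  have hI : ∀ x ∉ C, ∀ y ∉ C, ¬ G.Adj x y := fun x hx y hy hxy =>
    hI' (by simpa using hx) (by simpa using hy) hxy.ne hxy
  by_cases hall : ∀ x ∈ C, ∃ w ∉ C, G.Adj x w
  · exact ⟨C, hC', hI, hall⟩
  push Not at hall
  obtain ⟨x, hx, hxI⟩ := hall
  refine ⟨C.erase x, hC'.subset (by simp), ?_, ?_⟩
  · intro y hy z hz hyz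
    simp only [Finset.mem_erase, not_and_or, not_not] at hy hz
    have := hyz.ne
    rcases hy with rfl | hy <;> rcases hz with rfl | hz
    · exact this rfl
    · exact hxI z hz hyz
    · exact hxI y hy hyz.symm
    · exact hI y hy z hz hyz
  · intro y hy
    have hy := Finset.mem_erase.1 hy
    exact ⟨x, by simp, hC' hy.2 hx hy.1⟩

theorem exists_not_adj_of_two_le_omega {G : SimpleGraph V} {S : Finset V} (h : 2 ≤ omega G S) :
    ∃ x y, x ≠ y ∧ ¬ G.Adj x y := by
  by_contra! hc
  have : omega G S ≤ 1 := by
    by_cases hS : ∃ r, r ∉ S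
    · obtain ⟨r, hr⟩ := hS
      rw [← Finset.card_singleton r]
      refine omega_le_card fun x hx => ⟨r, by simp, hr, ?_⟩
      by_cases hxr : x = r
      · exact Or.inl hxr
      · exact Or.inr (Or.inl (hc r x (Ne.symm hxr)))
    · push Not at hS
      exact (omega_le_card (R := ∅) fun x hx => absurd (hS x) hx).trans (by simp)
  omega

theorem IsTough.exists_adj {G : SimpleGraph V} {t : ℝ} (ht : 0 < t) (hG : IsTough G t)
    (hnc : ∃ x y : V, x ≠ y ∧ ¬ G.Adj x y) (x : V) : ∃ y, G.Adj x y := by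
  by_contra! hx
  obtain ⟨z, hz⟩ : ∃ z, z ≠ x := by
    obtain ⟨a, b, hab, _⟩ := hnc
    by_cases ha : a = x
    · exact ⟨b, fun h => hab (ha.trans h.symm)⟩
    · exact ⟨a, ha⟩
  have := hG.mul_card_add_one_le ht (S := ∅) (J := {x}) (z := z) (by
    intro w hw
    obtain rfl := Finset.mem_singleton.1 hw
    exact ⟨by simp, fun y hy => absurd hy (hx y)⟩) (by simp) (by simpa using hz) (by simp)
  simp at this
  linarith

open Classical in
theorem card_strangers_le_sum {G : SimpleGraph V} {C : Finset V} (h : IsPendantClique G C)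
    (u v : V) : (strangers G C u v).card ≤ ∑ x ∈ C \ {u, v}, (leaves G C x).card := by
  refine le_trans (Finset.card_le_card ?_) Finset.card_biUnion_le
  intro w hw
  have hw := mem_strangers.1 hw
  obtain ⟨p, hp, hp'⟩ := h.pendant w hw.1
  have hpw : G.Adj p w := ((hp' p).2 rfl).symm
  refine Finset.mem_biUnion.2 ⟨p, Finset.mem_sdiff.2 ⟨hp, ?_⟩, mem_leaves.2 ⟨hw.1, hpw⟩⟩
  simp only [Finset.mem_insert, Finset.mem_singleton, not_or]
  exact ⟨fun e => hw.2.1 (e ▸ hpw), fun e => hw.2.2 (e ▸ hpw)⟩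

/-- The tightness condition forces the toughness of a clique with pendant vertices to be the
reciprocal of an integer. -/
theorem IsPendantClique.exists_nat {G : SimpleGraph V} {t : ℝ} (ht : 0 < t) {C : Finset V}
    (h : IsPendantClique G C) (hl : ∀ x ∈ C, t * ((leaves G C x).card + 1) ≤ 1)
    (htight : ∃ S : Finset V, 2 ≤ omega G S ∧ (S.card : ℝ) ≤ t * omega G S) :
    ∃ m : ℕ, 0 < m ∧ t = 1 / m ∧ (∀ x ∈ C, (leaves G C x).card + 1 ≤ m) ∧
      ∃ x ∈ C, (leaves G C x).card + 1 = m := by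
  obtain ⟨x, hx, hxt⟩ := h.exists_eq ht hl htight
  refine ⟨(leaves G C x).card + 1, by omega, ?_, fun y hy => ?_, x, hx, rfl⟩
  · have : ((leaves G C x).card : ℝ) + 1 ≠ 0 := by positivity
    push_cast
    field_simp
    linarith
  · exact_mod_cast le_of_mul_le_mul_left ((hl y hy).trans_eq hxt.symm) ht

/-- A minimally tough split graph is extremal. -/
theorem exists_isExtremal {G : SimpleGraph V} {t : ℝ} (ht : 0 < t) (hS : IsSplit G)
    (hG : IsMinimallyTough G t) : ∃ m : ℕ, 2 ≤ m ∧ t = 1 / m ∧ ∃ C, IsExtremal G m C := by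
  classical
  obtain ⟨hT, htight, hcrit⟩ := (isMinimallyTough_iff ht).1 hG
  have hnc : ∃ x y, x ≠ y ∧ ¬ G.Adj x y := by
    obtain ⟨S, hS, _⟩ := htight
    exact exists_not_adj_of_two_le_omega hS
  have hiso := hT.exists_adj ht hnc
  obtain ⟨C, hC, hI, hleaf⟩ := hS.exists_partition
  have hP : IsPendantClique G C := by
    refine ⟨hC, fun u hu => ?_⟩
    obtain ⟨p, hp⟩ := hiso u
    have hpC : p ∈ C := by
      by_contra hpC
      exact hI u hu p hpC hp
    refine ⟨p, hpC, fun v => ⟨fun hv => ?_, fun hv => hv ▸ hp⟩⟩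
    have hvC : v ∈ C := by
      by_contra hvC
      exact hI u hu v hvC hv
    exact eq_of_common ht hT hcrit hnc hC hI hleaf hvC hpC hu hv.symm hp.symm
  have hone : ∀ x ∈ C, 1 ≤ (leaves G C x).card := fun x hx => by
    obtain ⟨w, hw, hxw⟩ := hleaf x hx
    exact Finset.card_pos.2 ⟨w, mem_leaves.2 ⟨hw, hxw⟩⟩
  have hCne : C.Nonempty := by
    by_contra h0
    obtain rfl := Finset.not_nonempty_iff_eq_empty.1 h0
    obtain ⟨x, _, _⟩ := hnc
    obtain ⟨p, hp, _⟩ := hP.pendant x (by simp)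
    simp at hp
  rcases Nat.lt_or_ge 1 C.card with hC2 | hC1
  · have hl : ∀ x ∈ C, t * ((leaves G C x).card + 1) ≤ 1 := by
      intro x hx
      obtain ⟨z, hz, hzx⟩ := Finset.exists_mem_ne hC2 x
      have := hT.mul_card_add_one_le ht (S := {x}) (J := leaves G C x) (z := z) (fun w hw => by
        have hw := mem_leaves.1 hw
        refine ⟨fun h => hw.1 (Finset.mem_singleton.1 h ▸ hx), fun y hy => ?_⟩
        exact Finset.mem_singleton.2 (hP.eq_of_adj hw.1 hy.symm hw.2)) (by simpa using hzx)
        (fun h => (mem_leaves.1 h).1 hz) (Finset.card_pos.1 (hone x hx))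
      simpa using this
    obtain ⟨m, hm0, hm, hle, x, hx, hxm⟩ := hP.exists_nat ht hl htight
    have hm0' : (0 : ℝ) < m := by exact_mod_cast hm0
    have hm2 : 2 ≤ m := by
      have := hone x hx
      omega
    -- criticality of the clique edges, in natural numbers
    have hstar : ∀ u ∈ C, ∀ v ∈ C, u ≠ v → m * C.card < 2 + (strangers G C u v).card + 2 * m := by
      intro u hu v hv huv
      have h₁ := hT.lt_of_critical ht hC hu hv huv (hcrit u v (hC hu hv huv))
      rw [hm, div_mul_eq_mul_div, one_mul, lt_div_iff₀ hm0'] at h₁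
      have h₂ : (0 : ℝ) ≤ (leaves G C u ∩ leaves G C v).card := Nat.cast_nonneg _
      have : (m : ℝ) * C.card < 2 + (strangers G C u v).card + 2 * m := by nlinarith
      exact_mod_cast this
    have hC3 : C.card ≤ 3 := by
      obtain ⟨u, hu, v, hv, huv⟩ := Finset.one_lt_card.1 hC2
      have h₁ := hstar u hu v hv huv
      have h₂ := card_strangers_le_sum hP u v
      have hsub : ({u, v} : Finset V) ⊆ C := by
        intro x hx
        simp only [Finset.mem_insert, Finset.mem_singleton] at hx
        rcases hx with rfl | rfl <;> assumption
      have h₃ : ∑ x ∈ C \ {u, v}, (leaves G C x).card ≤ (C \ {u, v}).card * (m - 1) := by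
        refine Finset.sum_le_card_nsmul _ _ _ fun x hx => ?_
        have := hle x (Finset.mem_sdiff.1 hx).1
        omega
      rw [Finset.card_sdiff_of_subset hsub, Finset.card_pair huv] at h₃
      obtain ⟨k, hk⟩ := Nat.exists_eq_add_of_le (show 2 ≤ C.card by omega)
      obtain ⟨l, rfl⟩ := Nat.exists_eq_add_of_le (show 1 ≤ m by omega)
      rw [hk] at h₁ h₃ ⊢
      simp only [Nat.add_sub_cancel_left] at h₃
      nlinarith
    refine ⟨m, hm2, hm, C, hP, hle, ⟨x, hx, hxm⟩, ?_⟩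
    rcases (show C.card = 2 ∨ C.card = 3 by omega) with h2 | h3
    · exact Or.inl h2
    refine Or.inr ⟨h3, fun z hz => le_antisymm (hle z hz) ?_⟩
    have : 1 < (C.erase z).card := by rw [Finset.card_erase_of_mem hz]; omega
    obtain ⟨u, hu, v, hv, huv⟩ := Finset.one_lt_card.1 this
    have hu := Finset.mem_erase.1 hu
    have hv := Finset.mem_erase.1 hv
    have h₁ := hstar u hu.2 v hv.2 huv
    have h₂ := card_strangers_le_sum hP u v
    obtain ⟨z', _, _, _, hz'⟩ := exists_third h3 hu.2 hv.2 huv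
    have hCz : C \ {u, v} = {z} := by
      ext x
      simp only [Finset.mem_sdiff, Finset.mem_insert, Finset.mem_singleton, not_or]
      constructor
      · rintro ⟨hx, h, h'⟩
        rw [hz' x hx h h', ← hz' z hz (Ne.symm hu.1) (Ne.symm hv.1)]
      · rintro rfl
        exact ⟨hz, Ne.symm hu.1, Ne.symm hv.1⟩
    rw [hCz, Finset.sum_singleton] at h₂
    rw [h3] at h₁
    omega
  · -- a star: take its centre and one of its leaves
    obtain ⟨c, rfl⟩ := Finset.card_eq_one.1 (le_antisymm hC1 hCne.card_pos)
    have hcadj : ∀ x, x ≠ c → ∀ y, G.Adj x y ↔ y = c := by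
      intro x hx y
      obtain ⟨p, hp, hp'⟩ := hP.pendant x (by simpa using hx)
      rw [hp' y, Finset.mem_singleton.1 hp]
    obtain ⟨w, hwc, hcw⟩ := hleaf c (by simp)
    have hwc : w ≠ c := by simpa using hwc
    have hP' : IsPendantClique G {c, w} := by
      refine ⟨?_, fun u hu => ?_⟩
      · intro x hx y hy hxy
        simp only [Finset.coe_insert, Finset.coe_singleton, Set.mem_insert_iff,
          Set.mem_singleton_iff] at hx hy
        rcases hx with rfl | rfl <;> rcases hy with rfl | rfl
        · exact absurd rfl hxy
        · exact hcw
        · exact hcw.symm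
        · exact absurd rfl hxy
      · simp only [Finset.mem_insert, Finset.mem_singleton, not_or] at hu
        exact ⟨c, by simp, hcadj u hu.1⟩
    have hlc : (leaves G {c, w} c).card + 1 = (leaves G {c} c).card := by
      rw [← Finset.card_insert_of_notMem (a := w) (by simp [mem_leaves])]
      congr 1
      ext x
      simp only [Finset.mem_insert, mem_leaves, Finset.mem_singleton, not_or]
      constructor
      · rintro (rfl | h)
        · exact ⟨hwc, hcw⟩
        · exact ⟨h.1.1, h.2⟩
      · rintro ⟨h, h'⟩
        by_cases hxw : x = w
        · exact Or.inl hxw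
        · exact Or.inr ⟨⟨h, hxw⟩, h'⟩
    have hlw : (leaves G {c, w} w).card = 0 := by
      rw [Finset.card_eq_zero, Finset.eq_empty_iff_forall_notMem]
      intro x hx
      have hx := mem_leaves.1 hx
      exact hx.1 (by simp [(hcadj w hwc x).1 hx.2])
    have h2 : 2 ≤ (leaves G {c} c).card := by
      obtain ⟨x, y, hxy, hn⟩ := hnc
      have hxc : x ≠ c := by
        rintro rfl
        exact hn ((hcadj y (Ne.symm hxy) x).2 rfl).symm
      have hyc : y ≠ c := by
        rintro rfl
        exact hn ((hcadj x hxy y).2 rfl)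
      refine Finset.one_lt_card.2 ⟨x, ?_, y, ?_, hxy⟩ <;> rw [mem_leaves]
      · exact ⟨by simpa using hxc, ((hcadj x hxc c).2 rfl).symm⟩
      · exact ⟨by simpa using hyc, ((hcadj y hyc c).2 rfl).symm⟩
    have h₁ := hT.mul_card_le ht (S := {c}) (J := leaves G {c} c) (fun x hx => by
      have hx := mem_leaves.1 hx
      exact ⟨hx.1, fun y hy => by simpa using (hcadj x (by simpa using hx.1) y).1 hy⟩) h2
    have h2' : (2 : ℝ) ≤ (leaves G {c} c).card := by exact_mod_cast h2
    have hlc' : ((leaves G {c, w} c).card : ℝ) + 1 = (leaves G {c} c).card := by exact_mod_cast hlc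
    simp only [Finset.card_singleton, Nat.cast_one] at h₁
    have hl : ∀ x ∈ ({c, w} : Finset V), t * ((leaves G {c, w} x).card + 1) ≤ 1 := by
      intro x hx
      simp only [Finset.mem_insert, Finset.mem_singleton] at hx
      rcases hx with rfl | rfl
      · rw [hlc']
        exact h₁
      · rw [hlw]
        push_cast
        nlinarith
    obtain ⟨m, hm0, hm, hle, x, hx, hxm⟩ := hP'.exists_nat ht hl htight
    refine ⟨m, ?_, hm, {c, w}, hP', hle, ⟨x, hx, hxm⟩, Or.inl (Finset.card_pair hwc.symm)⟩
    have := hle c (by simp)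
    omega

end Graph

/-! ### Logical formulas as arithmetic expressions -/

namespace Expr

/-- An expression read as a formula: it holds if its value is not zero. -/
def Holds (w : List Bool) (e : Expr) (v : ℕ → ℕ) : Prop := e.eval w v ≠ 0

/-- Negation. -/
def not (a : Expr) : Expr := tsub one a

/-- Disjunction. -/
def or (a b : Expr) : Expr := add a b

/-- Conjunction. -/
def and (a b : Expr) : Expr := not (or (not a) (not b))

/-- Implication. -/
def imp (a b : Expr) : Expr := or (not a) b

/-- Existential quantification over the values less than `b` of the variable `i`. -/
def ex (i : ℕ) (b e : Expr) : Expr := sum i b e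

/-- Universal quantification over the values less than `b` of the variable `i`. -/
def all (i : ℕ) (b e : Expr) : Expr := not (ex i b (not e))

/-- The order relation. -/
def le (a b : Expr) : Expr := not (tsub a b)

/-- Equality. -/
def eq (a b : Expr) : Expr := and (le a b) (le b a)

/-- Numerals. -/
def const : ℕ → Expr
  | 0 => tsub one one
  | k + 1 => add (const k) one

variable (w : List Bool) (a b e : Expr) (v : ℕ → ℕ) (i : ℕ)

theorem holds_not : (not a).Holds w v ↔ ¬ a.Holds w v := by
  simp only [Holds, not, eval]; omega

theorem holds_or : (or a b).Holds w v ↔ a.Holds w v ∨ b.Holds w v := by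
  simp only [Holds, or, eval]; omega

theorem holds_and : (and a b).Holds w v ↔ a.Holds w v ∧ b.Holds w v := by
  simp only [and, holds_not, holds_or]; tauto

theorem holds_imp : (imp a b).Holds w v ↔ (a.Holds w v → b.Holds w v) := by
  simp only [imp, holds_not, holds_or]; tauto

theorem holds_ex : (ex i b e).Holds w v ↔ ∃ x < b.eval w v, e.Holds w (update v i x) := by
  simp [Holds, ex, eval]

theorem holds_all : (all i b e).Holds w v ↔ ∀ x < b.eval w v, e.Holds w (update v i x) := by
  simp [all, holds_not, holds_ex]

theorem holds_le : (le a b).Holds w v ↔ a.eval w v ≤ b.eval w v := by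
  simp only [le, holds_not]
  simp only [Holds, eval]; omega

theorem holds_eq : (eq a b).Holds w v ↔ a.eval w v = b.eval w v := by
  simp only [eq, holds_and, holds_le]; omega

theorem holds_bit : (bit a).Holds w v ↔ w[a.eval w v]? = some true := by
  simp [Holds, eval]

open Classical in
theorem eval_and : (and a b).eval w v = if a.Holds w v ∧ b.Holds w v then 1 else 0 := by
  have h := holds_and w a b v
  split_ifs with hif
  · have := h.2 hif
    simp only [Holds, and, not, eval] at this ⊢
    omega
  · have := mt h.1 hif
    simpa [Holds] using this

theorem eval_const (k : ℕ) : (const k).eval w v = k := by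
  induction k with
  | zero => rfl
  | succ k ih => simp [const, eval, ih]

/-! ### Recognizing the extremal graphs -/

/-- Adjacency of the vertices held by the variables `i` and `j`, the number of vertices being held
by the variable `0`. The variable `8` is used for multiplication. -/
def adj (i j : ℕ) : Expr := bit (add (sum 8 (var i) (var 0)) (var j))

/-- The vertex held by the variable `i` is one of those held by the variables `3`, `4` and `5`. -/
def inCore (i : ℕ) : Expr := or (eq (var i) (var 3)) (or (eq (var i) (var 4)) (eq (var i) (var 5)))

/-- The number of neighbours outside the core of the vertex held by the variable `i`. -/
def numLeaves (i : ℕ) : Expr := sum 7 (var 0) (and (not (inCore 7)) (adj i 7))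

/-- The variables `3`, `4` and `5` hold the core of an extremal graph. -/
def extremal (m : ℕ) : Expr :=
  and (not (eq (var 3) (var 4))) <|
  and (not (eq (var 3) (var 5))) <|
  and (all 1 (var 0) <| all 2 (var 0) <|
    imp (inCore 1) <| imp (inCore 2) <| or (eq (var 1) (var 2)) (adj 1 2)) <|
  and (all 1 (var 0) <| or (inCore 1) <| ex 6 (var 0) <| and (inCore 6) <|
    all 2 (var 0) <| and (imp (adj 1 2) (eq (var 2) (var 6)))
      (imp (eq (var 2) (var 6)) (adj 1 2))) <|
  and (all 1 (var 0) <| imp (inCore 1) <| le (add (numLeaves 1) one) (const m)) <|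
  and (eq (add (numLeaves 3) one) (const m)) <|
  or (eq (var 4) (var 5)) <|
    all 1 (var 0) <| imp (inCore 1) <| eq (add (numLeaves 1) one) (const m)

/-- The string is the adjacency matrix of an extremal graph: for some number of vertices, held by the
variable `0`, it has the right length, is irreflexive and symmetric, and has a core. -/
def extremalString (m : ℕ) : Expr :=
  ex 0 (add len one) <|
  and (eq (sum 8 (var 0) (var 0)) len) <|
  and (all 1 (var 0) <| not (adj 1 1)) <|
  and (all 1 (var 0) <| all 2 (var 0) <| imp (adj 1 2) (adj 2 1)) <|
  ex 3 (var 0) <| ex 4 (var 0) <| ex 5 (var 0) <| extremal m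

theorem holds_adj (j : ℕ) : (adj i j).Holds w v ↔
    w[v i * v 0 + v j]? = some true := by
  simp [adj, holds_bit, eval]

theorem holds_inCore : (inCore i).Holds w v ↔ v i = v 3 ∨ v i = v 4 ∨ v i = v 5 := by
  simp [inCore, holds_or, holds_eq, eval]

open Classical in
theorem eval_numLeaves (hi : i ≠ 7) : (numLeaves i).eval w v =
    ∑ x ∈ Finset.range (v 0), if ¬ (x = v 3 ∨ x = v 4 ∨ x = v 5) ∧
      w[v i * v 0 + x]? = some true then 1 else 0 := by
  simp [numLeaves, eval, eval_and, holds_not, holds_inCore, holds_adj, hi]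

end Expr

/-! ### Strings and graphs -/

/-- The string encoding a graph on `n` vertices has the adjacency of `i` and `j` at position
`i * n + j`. -/
theorem encodeGraph_eq_iff {n : ℕ} (G : SimpleGraph (Fin n)) (w : List Bool) :
    encodeGraph G = w ↔ w.length = n * n ∧
      ∀ i j : Fin n, w[(i * n + j : ℕ)]? = some true ↔ G.Adj i j := by
  have hbit : ∀ i j : Fin n, (encodeGraph G)[(i * n + j : ℕ)]? = some true ↔ G.Adj i j := by
    intro i j
    have hlt : (i * n + j : ℕ) < n * n := by
      have := i.2
      have := j.2
      nlinarith
    have e₁ : (⟨i * n + j, hlt⟩ : Fin (n * n)).divNat = i := by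
      ext
      simp [Fin.divNat, Nat.add_div_of_dvd_right (Dvd.intro_left _ rfl), Nat.div_eq_of_lt j.2,
        Nat.mul_div_cancel _ (Fin.pos i)]
    have e₂ : (⟨i * n + j, hlt⟩ : Fin (n * n)).modNat = j := by
      ext
      simp [Fin.modNat, Nat.mod_eq_of_lt j.2]
    rw [encodeGraph, List.getElem?_ofFn]
    simp [hlt, e₁, e₂]
  constructor
  · rintro rfl
    exact ⟨by simp [encodeGraph], hbit⟩
  · rintro ⟨hl, h⟩
    have hl' : (encodeGraph G).length = n * n := by simp [encodeGraph]
    refine List.ext_getElem (hl'.trans hl.symm) fun k h₁ h₂ => ?_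
    have hk : k < n * n := hl' ▸ h₁
    obtain ⟨i, j, rfl⟩ : ∃ i j : Fin n, k = i * n + j := by
      refine ⟨(⟨k, hk⟩ : Fin (n * n)).divNat, (⟨k, hk⟩ : Fin (n * n)).modNat, ?_⟩
      simp [Fin.divNat, Fin.modNat, Nat.div_add_mod']
    have := (hbit i j).trans (h i j).symm
    rw [List.getElem?_eq_getElem h₁, List.getElem?_eq_getElem h₂] at this
    rw [Bool.eq_iff_iff]
    simpa using this

/-- An extremal graph has a core `{x, y, z}`, where `y = z` if the core has only two vertices; the
vertex `x` is one with exactly `m - 1` pendant vertices. -/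
theorem exists_isExtremal_iff {V : Type*} [Fintype V] [DecidableEq V] {G : SimpleGraph V} {m : ℕ} :
    (∃ C, IsExtremal G m C) ↔ ∃ x y z : V, x ≠ y ∧ x ≠ z ∧
      IsPendantClique G {x, y, z} ∧
      (∀ i ∈ ({x, y, z} : Finset V), (leaves G {x, y, z} i).card + 1 ≤ m) ∧
      (leaves G {x, y, z} x).card + 1 = m ∧
      (y = z ∨ ∀ i ∈ ({x, y, z} : Finset V), (leaves G {x, y, z} i).card + 1 = m) := by
  constructor
  · rintro ⟨C, hC, hle, ⟨x, hx, hxm⟩, hcard⟩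
    have : ∃ y z, x ≠ y ∧ x ≠ z ∧ C = {x, y, z} ∧
        (y = z ∨ ∀ i ∈ C, (leaves G C i).card + 1 = m) := by
      rcases hcard with h2 | ⟨h3, hall⟩
      · obtain ⟨y, hy⟩ := Finset.card_eq_one.1
          (show (C.erase x).card = 1 by rw [Finset.card_erase_of_mem hx, h2])
        have hxy : y ∈ C.erase x := by simp [hy]
        have hne := (Finset.mem_erase.1 hxy).1
        refine ⟨y, y, hne.symm, hne.symm, ?_, Or.inl rfl⟩
        rw [← Finset.insert_erase hx, hy]
        simp
      · obtain ⟨y, z, _, hyz⟩ := Finset.card_eq_two.1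
          (show (C.erase x).card = 2 by rw [Finset.card_erase_of_mem hx, h3])
        have hy : y ∈ C.erase x := by simp [hyz]
        have hz : z ∈ C.erase x := by simp [hyz]
        refine ⟨y, z, (Finset.mem_erase.1 hy).1.symm, (Finset.mem_erase.1 hz).1.symm, ?_,
          Or.inr hall⟩
        rw [← Finset.insert_erase hx, hyz]
    obtain ⟨y, z, hxy, hxz, rfl, h⟩ := this
    exact ⟨x, y, z, hxy, hxz, hC, hle, hxm, h⟩
  · rintro ⟨x, y, z, hxy, hxz, hC, hle, hxm, h⟩
    refine ⟨{x, y, z}, hC, hle, ⟨x, by simp, hxm⟩, ?_⟩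
    by_cases hyz : y = z
    · subst hyz
      left
      simp [hxy]
    · exact Or.inr ⟨Finset.card_eq_three.2 ⟨x, y, z, hxy, hxz, hyz, rfl⟩, h.resolve_left hyz⟩

theorem isPendantClique_triple_iff {V : Type*} [DecidableEq V] {G : SimpleGraph V} {x y z : V} :
    IsPendantClique G {x, y, z} ↔
      (∀ i j, (i = x ∨ i = y ∨ i = z) → (j = x ∨ j = y ∨ j = z) → i = j ∨ G.Adj i j) ∧
      ∀ i, (i = x ∨ i = y ∨ i = z) ∨ ∃ p, (p = x ∨ p = y ∨ p = z) ∧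
        ∀ j, (G.Adj i j → j = p) ∧ (j = p → G.Adj i j) := by
  constructor
  · rintro ⟨h₁, h₂⟩
    refine ⟨fun i j hi hj => or_iff_not_imp_left.2 fun hij => ?_, fun i => or_iff_not_imp_left.2
      fun hi => ?_⟩
    · exact h₁ (by simpa using hi) (by simpa using hj) hij
    · obtain ⟨p, hp, hp'⟩ := h₂ i (by simpa using hi)
      exact ⟨p, by simpa using hp, fun j => ⟨(hp' j).1, (hp' j).2⟩⟩
  · rintro ⟨h₁, h₂⟩
    refine ⟨fun i hi j hj hij => ?_, fun i hi => ?_⟩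
    · exact (h₁ i j (by simpa using hi) (by simpa using hj)).resolve_left hij
    · obtain ⟨p, hp, hp'⟩ := (h₂ i).resolve_left (by simpa using hi)
      exact ⟨p, by simpa using hp, fun j => ⟨(hp' j).1, (hp' j).2⟩⟩

open Classical in
theorem card_leaves_eq_sum {n : ℕ} {G : SimpleGraph (Fin n)} {w : List Bool}
    (h : ∀ i j : Fin n, w[(i * n + j : ℕ)]? = some true ↔ G.Adj i j) (x y z i : Fin n) :
    (leaves G {x, y, z} i).card = ∑ k ∈ Finset.range n,
      if ¬ (k = (x : ℕ) ∨ k = (y : ℕ) ∨ k = (z : ℕ)) ∧ w[(i * n + k : ℕ)]? = some true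
        then 1 else 0 := by
  rw [leaves, Finset.card_filter, Finset.sum_range]
  refine Finset.sum_congr rfl fun k _ => ?_
  simp only [← h, Finset.mem_insert, Finset.mem_singleton, Fin.ext_iff]

theorem Expr.holds_extremal {n m : ℕ} {G : SimpleGraph (Fin n)} {w : List Bool}
    (h : ∀ i j : Fin n, w[(i * n + j : ℕ)]? = some true ↔ G.Adj i j) (x y z : Fin n)
    {v : ℕ → ℕ} (h0 : v 0 = n) (h3 : v 3 = x) (h4 : v 4 = y) (h5 : v 5 = z) :
    (Expr.extremal m).Holds w v ↔ x ≠ y ∧ x ≠ z ∧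
      IsPendantClique G {x, y, z} ∧
      (∀ i ∈ ({x, y, z} : Finset (Fin n)), (leaves G {x, y, z} i).card + 1 ≤ m) ∧
      (leaves G {x, y, z} x).card + 1 = m ∧
      (y = z ∨ ∀ i ∈ ({x, y, z} : Finset (Fin n)), (leaves G {x, y, z} i).card + 1 = m) := by
  classical
  have h' : ∀ i hi j hj, G.Adj ⟨i, hi⟩ ⟨j, hj⟩ ↔ w[i * n + j]? = some true :=
    fun i hi j hj => (h ⟨i, hi⟩ ⟨j, hj⟩).symm
  simp only [isPendantClique_triple_iff, card_leaves_eq_sum h, Finset.mem_insert,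
    Finset.mem_singleton, Fin.forall_iff, Fin.exists_iff, Fin.ext_iff, h', ne_eq,
    exists_prop]
  simp only [Expr.extremal, Expr.holds_and, Expr.holds_not, Expr.holds_or, Expr.holds_imp,
    Expr.holds_all, Expr.holds_ex, Expr.holds_eq, Expr.holds_le, Expr.holds_adj,
    Expr.holds_inCore, Expr.eval, Expr.eval_const, Expr.eval_numLeaves w _ 1 (by decide),
    Expr.eval_numLeaves w _ 3 (by decide), update_apply, h0, h3, h4, h5]
  simp [and_assoc]

theorem Expr.holds_extremalString {m : ℕ} (w : List Bool) :
    (Expr.extremalString m).Holds w (fun _ => 0) ↔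
      ∃ (n : ℕ) (G : SimpleGraph (Fin n)), (∃ C, IsExtremal G m C) ∧ encodeGraph G = w := by
  simp only [Expr.extremalString, Expr.holds_and, Expr.holds_not, Expr.holds_imp, Expr.holds_all,
    Expr.holds_ex, Expr.holds_eq, Expr.holds_adj]
  constructor
  · rintro ⟨n, -, hn, hirr, hsymm, x, hx, y, hy, z, hz, hex⟩
    simp [Expr.eval] at hn hirr hsymm hx hy hz
    let G : SimpleGraph (Fin n) :=
      { Adj := fun i j => w[(i * n + j : ℕ)]? = some true
        symm := ⟨fun i j hij => hsymm i i.2 j j.2 hij⟩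
        loopless := ⟨fun i hi => hirr i i.2 hi⟩ }
    have hG : ∀ i j : Fin n, w[(i * n + j : ℕ)]? = some true ↔ G.Adj i j := fun _ _ => Iff.rfl
    have := (Expr.holds_extremal hG ⟨x, hx⟩ ⟨y, hy⟩ ⟨z, hz⟩ (by simp) (by simp) (by simp)
      (by simp)).1 hex
    exact ⟨n, G, exists_isExtremal_iff.2 ⟨_, _, _, this⟩, (encodeGraph_eq_iff G w).2 ⟨hn.symm, hG⟩⟩
  · rintro ⟨n, G, hC, hw⟩
    obtain ⟨hn, hG⟩ := (encodeGraph_eq_iff G w).1 hw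
    obtain ⟨x, y, z, h⟩ := exists_isExtremal_iff.1 hC
    have hle : n ≤ n * n := Nat.le_mul_self n
    refine ⟨n, by simp [Expr.eval]; omega, by simp [Expr.eval, hn], ?_, ?_, x, by simp [Expr.eval],
      y, by simp [Expr.eval], z, by simp [Expr.eval],
      (Expr.holds_extremal hG x y z (by simp) (by simp) (by simp) (by simp)).2 h⟩
    · intro i hi
      have hi : i < n := by simpa [Expr.eval] using hi
      simpa using mt (hG ⟨i, hi⟩ ⟨i, hi⟩).1 G.irrefl
    · intro i hi j hj hij
      have hi : i < n := by simpa [Expr.eval] using hi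
      have hj : j < n := by simpa [Expr.eval] using hj
      have hij : w[i * n + j]? = some true := by simpa using hij
      simpa using (hG ⟨j, hj⟩ ⟨i, hi⟩).2 ((hG ⟨i, hi⟩ ⟨j, hj⟩).1 hij).symm

end ToughSplit

theorem mainTheorem9 (t : ℚ) (ht : 0 < t) :
    ToughSplit.InP {w : List Bool | ∃ (n : ℕ) (G : SimpleGraph (Fin n)),
      ToughSplit.IsSplit G ∧ ToughSplit.IsMinimallyTough G (t : ℝ) ∧
        ToughSplit.encodeGraph G = w} := by
  have ht' : (0 : ℝ) < t := by exact_mod_cast ht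
  by_cases h : ∃ m : ℕ, 2 ≤ m ∧ (t : ℝ) = 1 / m
  · obtain ⟨m, hm, htm⟩ := h
    convert! ToughSplit.inP_of_expr (ToughSplit.Expr.extremalString m) using 2
    funext w
    refine propext (Iff.trans ?_ (ToughSplit.Expr.holds_extremalString w).symm)
    constructor
    · rintro ⟨n, G, hS, hG, hw⟩
      obtain ⟨m', _, htm', hC⟩ := ToughSplit.exists_isExtremal ht' hS hG
      have : m' = m := by
        have h₁ := htm'.symm.trans htm
        simpa using h₁
      exact ⟨n, G, this ▸ hC, hw⟩
    · rintro ⟨n, G, ⟨C, hC⟩, hw⟩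
      exact ⟨n, G, hC.isSplit, htm ▸ hC.isMinimallyTough hm, hw⟩
  · -- no graph has the required property
    convert! ToughSplit.inP_of_expr (ToughSplit.Expr.const 0) using 2
    funext w
    refine propext ⟨?_, fun hw => absurd (ToughSplit.Expr.eval_const w _ 0) hw⟩
    rintro ⟨n, G, hS, hG, hw⟩
    obtain ⟨m, hm, htm, _⟩ := ToughSplit.exists_isExtremal ht' hS hG
    exact absurd ⟨m, hm, htm⟩ h
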